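/- Let $d\ge 1$. For $j=0,1,2,\dots$ let $H_j$ be the (physicists') Hermite polynomial, with leading coefficient $2^j$ and orthogonal with respect to $e^{-x^2}$ on $\mathbb R$, and put $$\psi_j(x)=\frac{1}{\sqrt{2^j j!\sqrt\pi}}\,H_j(x)\,e^{-x^2/2}\quad(x\in\mathbb R),\qquad \Psi_{j_1,\dots,j_d}(x)=\prod_{k=1}^d\psi_{j_k}(x_k)\quad(x\in\mathbb R^d).$$ For $n\in\mathbb N$ define, for $x,x',X,X'\in\mathbb R^d$, $$\mathcal K_n^{\rm Fermi}(x,x')=\sum_{0\le j_1+\dots+j_d\le n-1}\Psi_{j_1,\dots,j_d}(x)\,\Psi_{j_1,\dots,j_d}(x'),\qquad \mathbb K_n^{\rm Fermi}(X,X')=n^{d/2}\,\mathcal K_n^{\rm Fermi}(\sqrt n\,X,\sqrt n\,X').$$ Let $\operatorname{Ai}(z)=\frac1{2\pi i}\int_{1-i\infty}^{1+i\infty}e^{-zt+t^3/3}\,dt$ be the Airy function. Fix $X\in\mathbb R^d$ with $|X|=\sqrt2$. Then, as $n\to\infty$, $$\frac{1}{(n^{2/3}\sqrt2)^d}\,\mathbb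 K_n^{\rm Fermi}\!\left(X+\frac{U}{n^{2/3}\sqrt2},\,X+\frac{V}{n^{2/3}\sqrt2}\right)=\frac1{(2\pi)^d}\int_{\mathbb R^d}e^{-i\langle Q,U-V\rangle}\int_0^\infty\operatorname{Ai}\!\left(2^{2/3}|Q|^2+\frac{\langle U+V,X\rangle}{2^{1/3}|X|}+s\right)ds\,d^dQ+\mathcal O\!\left(n^{-1/3}\right),$$ uniformly for $(U,V)$ in compact subsets of $\mathbb R^d\times\mathbb R^d$. Here the inner integral over $s$ converges absolutely for every $Q$, and its product with $e^{-i\langle Q,U-V\rangle}$ is Lebesgue integrable in $Q\in\mathbb R^d$, for all $U,V\in\mathbb R^d$. -/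

import Mathlib

open Filter Topology MeasureTheory

noncomputable section

namespace FermiEdge

/-- The physicists' Hermite polynomial `H_j` as a function on `ℝ`: the one with leading
coefficient `2 ^ j`, orthogonal for the weight `exp (-x ^ 2)`. It is expressed through Mathlib's
probabilists' polynomial `He_j` by `H_j x = 2 ^ (j / 2) * He_j (√2 * x)`. -/
def hermiteH (j : ℕ) (x : ℝ) : ℝ :=
  (√2) ^ j * Polynomial.aeval (√2 * x) (Polynomial.hermite j)

/-- `H_0 = 1`, `H_1 = 2 x` and `H_2 = 4 x ^ 2 - 2`: a check of the normalization. -/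
theorem hermiteH_zero_one_two (x : ℝ) :
    hermiteH 0 x = 1 ∧ hermiteH 1 x = 2 * x ∧ hermiteH 2 x = 4 * x ^ 2 - 2 := by
  have h : √2 * √2 = (2 : ℝ) := Real.mul_self_sqrt (by norm_num)
  refine ⟨by simp [hermiteH], ?_, ?_⟩
  · simp [hermiteH, ← mul_assoc, h]
  · simp [hermiteH, Polynomial.hermite_succ]
    linear_combination (2 * x ^ 2) * h

/-- The normalized eigenfunctions of the one-dimensional harmonic oscillator. -/
def psi (j : ℕ) (x : ℝ) : ℝ :=
  1 / √(2 ^ j * (j.factorial : ℝ) * √Real.pi) * hermiteH j x * Real.exp (-(x ^ 2) / 2)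

/-- The eigenfunctions of the `d`-dimensional harmonic oscillator, for a multi-index `j`. -/
def Psi {d : ℕ} (j : Fin d → ℕ) (x : EuclideanSpace ℝ (Fin d)) : ℝ :=
  ∏ k, psi (j k) (x k)

/-- The multi-indices `j` of length `d` with `j_1 + ... + j_d ≤ n - 1`, that is, `|j| < n`. -/
def multiIndices (d n : ℕ) : Finset (Fin d → ℕ) :=
  (Fintype.piFinset fun _ : Fin d => Finset.range n).filter fun j => ∑ k, j k < n

theorem mem_multiIndices {d n : ℕ} (j : Fin d → ℕ) :
    j ∈ multiIndices d n ↔ ∑ k, j k < n := by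
  simp only [multiIndices, Finset.mem_filter, Fintype.mem_piFinset, Finset.mem_range,
    and_iff_right_iff_imp]
  intro h k
  exact lt_of_le_of_lt (Finset.single_le_sum (fun i _ => Nat.zero_le (j i)) (Finset.mem_univ k)) h

/-- The correlation kernel of the fermions in the `d`-dimensional harmonic oscillator. -/
def fermiKernel (d n : ℕ) (x x' : EuclideanSpace ℝ (Fin d)) : ℝ :=
  ∑ j ∈ multiIndices d n, Psi j x * Psi j x'

/-- The rescaled kernel `n ^ (d / 2) * K_n (√n X, √n X')`. -/
def scaledFermiKernel (d n : ℕ) (X X' : EuclideanSpace ℝ (Fin d)) : ℝ :=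
  (n : ℝ) ^ ((d : ℝ) / 2) * fermiKernel d n (√(n : ℝ) • X) (√(n : ℝ) • X')

/-- The integrand `exp (-z t + t ^ 3 / 3)` of the Airy function on the vertical line
`t = 1 + i y`. -/
def airyIntegrand (z : ℂ) (y : ℝ) : ℂ :=
  Complex.exp (-z * (1 + y * Complex.I) + (1 + y * Complex.I) ^ 3 / 3)

/-- The Airy function `Ai z = (1 / (2 π i)) ∫_Γ exp (-z t + t ^ 3 / 3) dt`, where `Γ` is the
upward vertical line `t = 1 + i y` (so that `dt = i dy`) in the right half-plane. -/
def airyAi (z : ℂ) : ℂ :=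
  1 / (2 * Real.pi) * ∫ y : ℝ, airyIntegrand z y

/-- The integral that defines the Airy function converges absolutely at every point. -/
theorem integrable_airyIntegrand (z : ℂ) : Integrable (airyIntegrand z) := by
  have hc : Continuous (airyIntegrand z) := by unfold airyIntegrand; fun_prop
  have hg : Integrable fun y : ℝ =>
      Real.exp (1 / 3 - z.re + z.im ^ 2 / 2) * Real.exp (-(1 / 2) * y ^ 2) :=
    (integrable_exp_neg_mul_sq (by norm_num)).const_mul _
  refine hg.mono' hc.aestronglyMeasurable (Eventually.of_forall fun y => ?_)
  have h3 : (1 + (y : ℂ) * Complex.I) ^ 3 / 3 =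
      ((1 / 3 - y ^ 2 : ℝ) : ℂ) + ((y - y ^ 3 / 3 : ℝ) : ℂ) * Complex.I := by
    push_cast
    linear_combination ((y : ℂ) ^ 2 + (y : ℂ) ^ 3 * Complex.I / 3) * Complex.I_sq
  rw [airyIntegrand, Complex.norm_exp, ← Real.exp_add, Real.exp_le_exp, h3]
  simp only [Complex.add_re, Complex.mul_re, Complex.neg_re, Complex.neg_im, Complex.one_re,
    Complex.add_im, Complex.one_im, Complex.mul_im, Complex.ofReal_re, Complex.ofReal_im,
    Complex.I_re, Complex.I_im]
  nlinarith [sq_nonneg (z.im - y)]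

/-- The inner integral `∫_0^∞ Ai (ζ + s) ds`. -/
def airyTail (ζ : ℝ) : ℂ :=
  ∫ s in Set.Ioi (0 : ℝ), airyAi ((ζ + s : ℝ) : ℂ)

/-- The integrand over `Q ∈ ℝ^d` in the `d`-dimensional Airy kernel. -/
def edgeIntegrand {d : ℕ} (X U V Q : EuclideanSpace ℝ (Fin d)) : ℂ :=
  Complex.exp (-Complex.I * ((inner ℝ Q (U - V) : ℝ) : ℂ)) *
    airyTail ((2 : ℝ) ^ (2 / 3 : ℝ) * ‖Q‖ ^ 2 + inner ℝ (U + V) X / ((2 : ℝ) ^ (1 / 3 : ℝ) * ‖X‖))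

/-- The `d`-dimensional Airy kernel in the direction of `X`. -/
def edgeKernel {d : ℕ} (X U V : EuclideanSpace ℝ (Fin d)) : ℂ :=
  1 / (2 * Real.pi) ^ d * ∫ Q : EuclideanSpace ℝ (Fin d), edgeIntegrand X U V Q

/-- The kernel at the edge point `X`, on the local scale `1 / (n ^ (2 / 3) √2)`. -/
def rescaledEdgeKernel {d : ℕ} (n : ℕ) (X U V : EuclideanSpace ℝ (Fin d)) : ℝ :=
  1 / ((n : ℝ) ^ (2 / 3 : ℝ) * √2) ^ d *
    scaledFermiKernel d n (X + (1 / ((n : ℝ) ^ (2 / 3 : ℝ) * √2)) • U)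
      (X + (1 / ((n : ℝ) ^ (2 / 3 : ℝ) * √2)) • V)

end FermiEdge

end

noncomputable section

namespace FermiEdge

open Complex (I)

/-! For `‖w‖ < 1` the generating function of `psi j x * psi j y` is Mehler's kernel
(`hasSum_mehler`). Multiplying over the coordinates collects the multi-indices by `|j|`, and the
further factor `1 / (1 - w)` adds up all levels `|j| ≤ N`. The kernel with `n = N + 1` is therefore
the `N`-th coefficient of an explicit function, and Fourier inversion on the circle `w = exp (-t)`,
`t = a + i θ`, writes it as an integral (`fermiKernel_eq_integral`).

In this variable Mehler's exponent is `-tanh (t/2) |x + y|² / 4 - coth (t/2) |x - y|² / 4`. At the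
edge `|x + y|² / 4 = 2 n + O(n^{1/3})`, so the linear part of `n t` is cancelled and `n (t - 2 tanh
(t/2)) ≈ n t³ / 12` remains. With `a³ = 4 / n` and `t = a σ` this is `σ³ / 3`, the exponent of the
Airy function; the circle becomes the segment `|y| ≤ π / a` of its contour `σ = 1 + i y`
(`rescaledEdgeKernel_eq`).

On the limit side, insert the contour integral of `Ai` and exchange integrals: the `s`-integral
gives `1 / σ` and the `Q`-integral is Gaussian. The result is an integral over the same contour with
the same prefactor (`edgeKernel_eq`).

It remains to compare two integrands. They differ by `O(a |σ|⁴)` times a fixed Gaussian in `y`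
(`norm_finiteIntegrand_sub_limitIntegrand_le`), and `a` is of order `n^{-1/3}`. The Gaussian bound
must hold on the whole circle, also far from the saddle; it comes from the growth of `Re tanh (t/2)`
along the circle (`halfTanh_re_ge`). -/

/-! ### Hermite polynomials as complex Gaussian moments -/

theorem derivative_hermite_succ (n : ℕ) :
    Polynomial.derivative (Polynomial.hermite (n + 1)) =
      ((n + 1 : ℕ) : Polynomial ℤ) * Polynomial.hermite n := by
  induction n with
  | zero => simp
  | succ n ih =>
    rw [Polynomial.hermite_succ (n + 1), Polynomial.derivative_sub, Polynomial.derivative_mul,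
      Polynomial.derivative_X, ih, Polynomial.derivative_mul, Polynomial.derivative_natCast,
      Polynomial.hermite_succ n]
    push_cast
    ring

theorem hermite_add_two (n : ℕ) :
    Polynomial.hermite (n + 2) =
      Polynomial.X * Polynomial.hermite (n + 1) -
        ((n + 1 : ℕ) : Polynomial ℤ) * Polynomial.hermite n := by
  rw [Polynomial.hermite_succ (n + 1), derivative_hermite_succ]

theorem norm_sq_add_mul_I (x s : ℝ) : ‖(x : ℂ) + s * I‖ ^ 2 = x ^ 2 + s ^ 2 := by
  rw [← Complex.normSq_eq_norm_sq, Complex.normSq_add_mul_I]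

/-- With `z = x + i s`, `|z|^n ≤ n! exp |z|` and `|z| ≤ 1 + |z|² / 4`, so the weight `exp (-s² / 2)`
still leaves `exp (-s² / 4)`. -/
theorem integrable_pow_mul_gaussian (x : ℝ) (n : ℕ) :
    Integrable fun s : ℝ => ((x : ℂ) + s * I) ^ n * Complex.exp (-(s : ℂ) ^ 2 / 2) := by
  have hg : Integrable fun s : ℝ =>
      (n.factorial * Real.exp (1 + x ^ 2 / 4)) * Real.exp (-(1 / 4) * s ^ 2) :=
    (integrable_exp_neg_mul_sq (by norm_num)).const_mul _
  refine hg.mono' (by fun_prop) (Eventually.of_forall fun s => ?_)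
  have h1 := Real.pow_div_factorial_le_exp _ (norm_nonneg ((x : ℂ) + s * I)) n
  rw [div_le_iff₀ (by positivity)] at h1
  have h2 := norm_sq_add_mul_I x s
  have h3 : ‖Complex.exp (-(s : ℂ) ^ 2 / 2)‖ = Real.exp (-s ^ 2 / 2) := by
    rw [Complex.norm_exp]; norm_cast
  rw [norm_mul, norm_pow, h3]
  calc _ ≤ (Real.exp ‖(x : ℂ) + s * I‖ * n.factorial) * Real.exp (-s ^ 2 / 2) := by gcongr
    _ ≤ (Real.exp (1 + (x ^ 2 + s ^ 2) / 4) * n.factorial) * Real.exp (-s ^ 2 / 2) := by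
      gcongr
      nlinarith [sq_nonneg (‖(x : ℂ) + s * I‖ - 2)]
    _ = _ := by
      rw [show 1 + (x ^ 2 + s ^ 2) / 4 = (1 + x ^ 2 / 4) + s ^ 2 / 4 by ring, Real.exp_add,
        show -(1 / 4) * s ^ 2 = s ^ 2 / 4 + -s ^ 2 / 2 by ring, Real.exp_add (s ^ 2 / 4)]
      ring

/-- The moment `∫ (x + i s) ^ n exp (-s ^ 2 / 2) ds`. -/
def hermiteMoment (n : ℕ) (x : ℝ) : ℂ :=
  ∫ s : ℝ, ((x : ℂ) + s * I) ^ n * Complex.exp (-(s : ℂ) ^ 2 / 2)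

theorem integral_exp_neg_sq_div_two :
    ∫ s : ℝ, Complex.exp (-(s : ℂ) ^ 2 / 2) = (√(2 * Real.pi) : ℝ) := by
  have h : ∀ s : ℝ, Complex.exp (-(s : ℂ) ^ 2 / 2) = (Real.exp (-(1 / 2) * s ^ 2) : ℝ) := by
    intro s; push_cast; ring_nf
  simp_rw [h]
  rw [integral_complex_ofReal, integral_gaussian]
  congr 2; ring

/-- Integration by parts, since `s exp (-s² / 2)` is the derivative of `-exp (-s² / 2)`. This yields
the three-term recurrence of the moments. -/
theorem integral_pow_mul_self_mul_gaussian (x : ℝ) (n : ℕ) :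
    ∫ s : ℝ, ((x : ℂ) + s * I) ^ (n + 1) * ((s : ℂ) * Complex.exp (-(s : ℂ) ^ 2 / 2)) =
      (n + 1) * I * hermiteMoment n x := by
  have hu : ∀ s : ℝ, HasDerivAt (fun s : ℝ => ((x : ℂ) + s * I) ^ (n + 1))
      ((n + 1) * ((x : ℂ) + s * I) ^ n * I) s := by
    intro s
    have h := ((Complex.ofRealCLM.hasDerivAt (x := s)).mul_const I).const_add (x : ℂ)
    refine (h.pow (n + 1)).congr_deriv ?_
    simp
  have hv : ∀ s : ℝ, HasDerivAt (fun s : ℝ => -Complex.exp (-(s : ℂ) ^ 2 / 2))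
      ((s : ℂ) * Complex.exp (-(s : ℂ) ^ 2 / 2)) s := by
    intro s
    have h := (((Complex.ofRealCLM.hasDerivAt (x := s)).pow 2).neg.div_const 2).cexp.neg
    refine h.congr_deriv ?_
    simp; ring
  have i1 := integrable_pow_mul_gaussian x (n + 1)
  have i0 := integrable_pow_mul_gaussian x n
  have i2 := integrable_pow_mul_gaussian x (n + 2)
  have key := integral_mul_deriv_eq_deriv_mul_of_integrable (fun s _ => hu s) (fun s _ => hv s)
    ?_ ?_ ?_
  · rw [key, hermiteMoment, ← integral_const_mul, ← integral_neg]
    congr 1; ext s; ring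
  · have h : ((fun s : ℝ => ((x : ℂ) + s * I) ^ (n + 1)) *
        fun s : ℝ => (s : ℂ) * Complex.exp (-(s : ℂ) ^ 2 / 2)) = fun s : ℝ =>
        (-I) * (((x : ℂ) + s * I) ^ (n + 2) * Complex.exp (-(s : ℂ) ^ 2 / 2)) +
        (I * x) * (((x : ℂ) + s * I) ^ (n + 1) * Complex.exp (-(s : ℂ) ^ 2 / 2)) := by
      ext s
      simp only [Pi.mul_apply]
      linear_combination ((s : ℂ) * ((x : ℂ) + s * I) ^ (n + 1) *
        Complex.exp (-(s : ℂ) ^ 2 / 2)) * Complex.I_sq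
    rw [h]
    exact (i2.const_mul _).add (i1.const_mul _)
  · refine (i0.const_mul (-((n + 1) * I))).congr (Eventually.of_forall fun s => ?_)
    simp only [Pi.mul_apply]; ring
  · refine i1.neg.congr (Eventually.of_forall fun s => ?_)
    simp

theorem hermiteMoment_add_two (n : ℕ) (x : ℝ) :
    hermiteMoment (n + 2) x = x * hermiteMoment (n + 1) x - (n + 1) * hermiteMoment n x := by
  have i1 := integrable_pow_mul_gaussian x (n + 1)
  have i2 := integrable_pow_mul_gaussian x (n + 2)
  have h : (n + 1) * I * hermiteMoment n x =
      -I * hermiteMoment (n + 2) x + I * x * hermiteMoment (n + 1) x := by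
    rw [← integral_pow_mul_self_mul_gaussian, hermiteMoment, hermiteMoment, ← integral_const_mul,
      ← integral_const_mul, ← integral_add (i2.const_mul _) (i1.const_mul _)]
    congr 1; ext s
    linear_combination ((s : ℂ) * ((x : ℂ) + s * I) ^ (n + 1) *
        Complex.exp (-(s : ℂ) ^ 2 / 2)) * Complex.I_sq
  linear_combination -I * h + (hermiteMoment (n + 2) x + (n + 1) * hermiteMoment n x -
    x * hermiteMoment (n + 1) x) * Complex.I_sq

/-- Moments and polynomials obey the same three-term recurrence, so agreement at `0` and `1`
suffices. The representation has `n` only as an exponent, which makes the generating function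
summable in closed form. -/
theorem hermiteMoment_eq (n : ℕ) (x : ℝ) :
    hermiteMoment n x =
      (√(2 * Real.pi) : ℝ) * (Polynomial.aeval x (Polynomial.hermite n) : ℝ) := by
  induction n using Nat.strong_induction_on with
  | _ n ih =>
    match n, ih with
    | 0, _ => simp [hermiteMoment, integral_exp_neg_sq_div_two]
    | 1, _ =>
      have i0 := integrable_pow_mul_gaussian x 0
      have hodd : ∫ s : ℝ, (s : ℂ) * Complex.exp (-(s : ℂ) ^ 2 / 2) = 0 := by
        have h := integral_neg_eq_self (fun s : ℝ => (s : ℂ) * Complex.exp (-(s : ℂ) ^ 2 / 2))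
          volume
        simp only [Complex.ofReal_neg, neg_mul, integral_neg, neg_sq] at h
        linear_combination (-1 / 2) * h
      have i1 : Integrable fun s : ℝ => (s : ℂ) * Complex.exp (-(s : ℂ) ^ 2 / 2) := by
        have h := (integrable_pow_mul_gaussian 0 1).const_mul (-I)
        refine h.congr (Eventually.of_forall fun s => ?_)
        simp only [Complex.ofReal_zero, zero_add, pow_one]
        linear_combination (-(s : ℂ) * Complex.exp (-(s : ℂ) ^ 2 / 2)) * Complex.I_sq
      have h : ∀ s : ℝ, ((x : ℂ) + s * I) ^ 1 * Complex.exp (-(s : ℂ) ^ 2 / 2) =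
          x * (((x : ℂ) + s * I) ^ 0 * Complex.exp (-(s : ℂ) ^ 2 / 2)) +
            I * ((s : ℂ) * Complex.exp (-(s : ℂ) ^ 2 / 2)) := by intro s; ring
      rw [hermiteMoment]
      simp_rw [h]
      rw [integral_add (i0.const_mul _) (i1.const_mul _), integral_const_mul, integral_const_mul,
        hodd]
      simp [integral_exp_neg_sq_div_two, mul_comm]
    | n + 2, ih =>
      rw [hermiteMoment_add_two, ih n (by omega), ih (n + 1) (by omega), hermite_add_two]
      simp only [map_sub, map_mul, Polynomial.aeval_X, map_natCast]
      push_cast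
      ring

/-! ### Mehler's formula -/

theorem hasSum_complex_exp (z : ℂ) :
    HasSum (fun n : ℕ => z ^ n / (n.factorial : ℂ)) (Complex.exp z) := by
  rw [Complex.exp_eq_exp_ℂ]
  exact NormedSpace.expSeries_div_hasSum_exp z

theorem hasSum_real_exp (x : ℝ) :
    HasSum (fun n : ℕ => x ^ n / (n.factorial : ℝ)) (Real.exp x) := by
  rw [Real.exp_eq_exp_ℝ]
  exact NormedSpace.expSeries_div_hasSum_exp x

/-- The two-variable Gaussian integrand whose integral is Mehler's kernel. -/
def mehlerIntegrand (w : ℂ) (x y : ℝ) (p : ℝ × ℝ) : ℂ :=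
  Complex.exp (w * (((x : ℂ) + p.1 * I) * ((y : ℂ) + p.2 * I))) *
    (Complex.exp (-(p.1 : ℂ) ^ 2 / 2) * Complex.exp (-(p.2 : ℂ) ^ 2 / 2))

/-- A dominating function for `mehlerIntegrand`. -/
def mehlerBound (r x y : ℝ) (p : ℝ × ℝ) : ℝ :=
  Real.exp (r * (‖(x : ℂ) + p.1 * I‖ * ‖(y : ℂ) + p.2 * I‖)) *
    (Real.exp (-p.1 ^ 2 / 2) * Real.exp (-p.2 ^ 2 / 2))

theorem integrable_mehlerBound {r : ℝ} (hr0 : 0 ≤ r) (hr : r < 1) (x y : ℝ) :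
    Integrable (mehlerBound r x y) := by
  have hb : 0 < (1 - r) / 2 := by linarith
  have hg := ((integrable_exp_neg_mul_sq hb).mul_prod (integrable_exp_neg_mul_sq hb)).const_mul
    (Real.exp (r * (x ^ 2 + y ^ 2) / 2))
  refine hg.mono' (Continuous.aestronglyMeasurable (by unfold mehlerBound; fun_prop))
    (Eventually.of_forall fun p => ?_)
  rw [mehlerBound, Real.norm_of_nonneg (by positivity), ← Real.exp_add, ← Real.exp_add,
    ← Real.exp_add, ← Real.exp_add, Real.exp_le_exp]
  have h1 := norm_sq_add_mul_I x p.1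
  have h2 := norm_sq_add_mul_I y p.2
  -- By `2 A B ≤ A² + B²` the growth costs at most `r (s² + u²) / 2` for `p = (s, u)`, leaving the
  -- decay rate `(1 - r) / 2` in each variable.
  have h3 := mul_le_mul_of_nonneg_left
    (two_mul_le_add_sq ‖(x : ℂ) + p.1 * I‖ ‖(y : ℂ) + p.2 * I‖) hr0
  rw [h1, h2] at h3
  nlinarith

theorem norm_exp_neg_sq_div_two (s : ℝ) :
    ‖Complex.exp (-(s : ℂ) ^ 2 / 2)‖ = Real.exp (-s ^ 2 / 2) := by
  rw [Complex.norm_exp]; norm_cast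

theorem integrable_mehlerIntegrand {w : ℂ} (hw : ‖w‖ < 1) (x y : ℝ) :
    Integrable (mehlerIntegrand w x y) := by
  refine (integrable_mehlerBound (norm_nonneg w) hw x y).mono'
    (Continuous.aestronglyMeasurable (by unfold mehlerIntegrand; fun_prop))
    (Eventually.of_forall fun p => ?_)
  rw [mehlerIntegrand, mehlerBound, norm_mul, norm_mul, norm_exp_neg_sq_div_two,
    norm_exp_neg_sq_div_two]
  gcongr
  rw [← norm_mul, ← norm_mul]
  exact Complex.norm_exp_le_exp_norm _

/-- A product of moments is a double integral, and summing over `j` inside it produces an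
exponential series. The norms of the terms serve as their own dominating sequence; their sum is
exactly `mehlerBound`. -/
theorem hasSum_hermiteMoment_mul {w : ℂ} (hw : ‖w‖ < 1) (x y : ℝ) :
    HasSum (fun j : ℕ => w ^ j / (j.factorial : ℂ) * (hermiteMoment j x * hermiteMoment j y))
      (∫ p, mehlerIntegrand w x y p) := by
  set F : ℕ → ℝ × ℝ → ℂ := fun j p => w ^ j / (j.factorial : ℂ) *
    ((((x : ℂ) + p.1 * I) ^ j * Complex.exp (-(p.1 : ℂ) ^ 2 / 2)) *
      (((y : ℂ) + p.2 * I) ^ j * Complex.exp (-(p.2 : ℂ) ^ 2 / 2))) with hF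
  have hnorm : ∀ j p, ‖F j p‖ = (‖w‖ * (‖(x : ℂ) + p.1 * I‖ * ‖(y : ℂ) + p.2 * I‖)) ^ j /
      (j.factorial : ℝ) * (Real.exp (-p.1 ^ 2 / 2) * Real.exp (-p.2 ^ 2 / 2)) := by
    intro j p
    simp only [hF, norm_mul, norm_div, norm_pow, norm_exp_neg_sq_div_two, Complex.norm_natCast]
    ring
  have hsum : ∀ p, HasSum (fun j => ‖F j p‖) (mehlerBound ‖w‖ x y p) := by
    intro p
    simp_rw [hnorm]
    exact (hasSum_real_exp _).mul_right _
  have key := hasSum_integral_of_dominated_convergence (μ := (volume : Measure (ℝ × ℝ)))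
    (F := F) (f := mehlerIntegrand w x y) (fun j p => ‖F j p‖)
    (fun j => Continuous.aestronglyMeasurable (by simp only [hF]; fun_prop))
    (fun j => Eventually.of_forall fun p => le_rfl)
    (Eventually.of_forall fun p => (hsum p).summable) ?_ (Eventually.of_forall fun p => ?_)
  · refine key.congr_fun ?_
    intro j
    simp only [hF]
    rw [integral_const_mul, Measure.volume_eq_prod, integral_prod_mul
      (fun s : ℝ => ((x : ℂ) + s * I) ^ j * Complex.exp (-(s : ℂ) ^ 2 / 2))
      (fun s : ℝ => ((y : ℂ) + s * I) ^ j * Complex.exp (-(s : ℂ) ^ 2 / 2))]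
    rfl
  · simp_rw [fun p => (hsum p).tsum_eq]
    exact integrable_mehlerBound (norm_nonneg w) hw x y
  · have h := (hasSum_complex_exp (w * (((x : ℂ) + p.1 * I) * ((y : ℂ) + p.2 * I)))).mul_right
      (Complex.exp (-(p.1 : ℂ) ^ 2 / 2) * Complex.exp (-(p.2 : ℂ) ^ 2 / 2))
    refine h.congr_fun fun j => ?_
    simp only [hF, mul_pow]
    ring

theorem one_sub_sq_re_pos {w : ℂ} (hw : ‖w‖ < 1) : 0 < (1 - w ^ 2).re := by
  have h : (w ^ 2).re ≤ ‖w‖ ^ 2 := by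
    rw [← norm_pow]; exact Complex.re_le_norm _
  have h2 : ‖w‖ ^ 2 < 1 := by nlinarith [norm_nonneg w]
  simp only [Complex.sub_re, Complex.one_re]
  linarith

theorem ofReal_mul_cpow {r : ℝ} (hr : 0 < r) {z : ℂ} (hz : z ≠ 0) (s : ℂ) :
    ((r : ℂ) * z) ^ s = (r : ℂ) ^ s * z ^ s := by
  have hr' : (r : ℂ) ≠ 0 := Complex.ofReal_ne_zero.2 hr.ne'
  rw [Complex.cpow_def_of_ne_zero (mul_ne_zero hr' hz), Complex.cpow_def_of_ne_zero hr',
    Complex.cpow_def_of_ne_zero hz, Complex.log_ofReal_mul hr hz, ← Complex.exp_add,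
    Complex.ofReal_log hr.le]
  ring_nf

theorem ofReal_cpow_half {r : ℝ} (hr : 0 ≤ r) : (r : ℂ) ^ (1 / 2 : ℂ) = (√r : ℝ) := by
  rw [Real.sqrt_eq_rpow, Complex.ofReal_cpow hr]
  norm_num

/-- Two successive complex Gaussian integrals. The inner one has a quadratic coefficient free of
`w`; completing its square turns the outer coefficient into `-(1 - w²) / 2`, which has negative real
part. -/
theorem integral_mehlerIntegrand {w : ℂ} (hw : ‖w‖ < 1) (x y : ℝ) :
    ∫ p, mehlerIntegrand w x y p = (2 * Real.pi : ℝ) * (1 / (1 - w ^ 2)) ^ (1 / 2 : ℂ) *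
      Complex.exp ((2 * w * x * y - w ^ 2 * (x ^ 2 + y ^ 2)) / (2 * (1 - w ^ 2))) := by
  have hre := one_sub_sq_re_pos hw
  have hne : (1 - w ^ 2) ≠ 0 := fun h => by simp [h] at hre
  have hi := integrable_mehlerIntegrand hw x y
  rw [Measure.volume_eq_prod] at hi ⊢
  rw [integral_prod _ hi]
  have hinner : ∀ s : ℝ, ∫ u : ℝ, mehlerIntegrand w x y (s, u) = (2 * Real.pi : ℂ) ^ (1 / 2 : ℂ) *
      Complex.exp ((-(1 - w ^ 2) / 2) * (s : ℂ) ^ 2 + (I * (w * y - w ^ 2 * x)) * s +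
        (w * x * y - w ^ 2 * x ^ 2 / 2)) := by
    intro s
    have h : ∀ u : ℝ, mehlerIntegrand w x y (s, u) = Complex.exp ((-1 / 2 : ℂ) * (u : ℂ) ^ 2 +
        (I * w * (x + s * I)) * u + (w * y * (x + s * I) - (s : ℂ) ^ 2 / 2)) := by
      intro u
      rw [mehlerIntegrand, ← Complex.exp_add, ← Complex.exp_add]
      congr 1; ring
    simp_rw [h]
    rw [integral_cexp_quadratic (by norm_num)]
    congr 1
    · congr 1; ring
    · congr 1
      linear_combination (w ^ 2 * (x + s * I) ^ 2 / 2 - w ^ 2 * s ^ 2 / 2) * Complex.I_sq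
  simp_rw [hinner]
  rw [integral_const_mul, integral_cexp_quadratic (by
    simp only [Complex.div_ofNat_re, Complex.neg_re]; linarith)]
  have h2 : (Real.pi : ℂ) / -(-(1 - w ^ 2) / 2) = ((2 * Real.pi : ℝ) : ℂ) * (1 / (1 - w ^ 2)) := by
    push_cast
    field_simp
  have h3 : (2 * Real.pi : ℂ) = ((2 * Real.pi : ℝ) : ℂ) := by push_cast; rfl
  have h4 : ((√(2 * Real.pi) : ℝ) : ℂ) * ((√(2 * Real.pi) : ℝ) : ℂ) = ((2 * Real.pi : ℝ) : ℂ) := by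
    rw [← Complex.ofReal_mul, Real.mul_self_sqrt (by positivity)]
  have h5 : w * x * y - w ^ 2 * x ^ 2 / 2 -
      (I * (w * y - w ^ 2 * x)) ^ 2 / (4 * (-(1 - w ^ 2) / 2)) =
      (2 * w * x * y - w ^ 2 * (x ^ 2 + y ^ 2)) / (2 * (1 - w ^ 2)) := by
    rw [mul_pow, Complex.I_sq]
    field_simp
    ring
  rw [h2, ofReal_mul_cpow (by positivity) (one_div_ne_zero hne), h3,
    ofReal_cpow_half (by positivity), h5, ← mul_assoc, ← mul_assoc, h4]

theorem psi_mul_psi (j : ℕ) (x y : ℝ) :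
    ((psi j x * psi j y : ℝ) : ℂ) = ((1 / √Real.pi * (1 / (2 * Real.pi)) : ℝ) : ℂ) *
      Complex.exp (-((x : ℂ) ^ 2 + (y : ℂ) ^ 2) / 2) *
      (1 / (j.factorial : ℂ) * (hermiteMoment j (√2 * x) * hermiteMoment j (√2 * y))) := by
  rw [hermiteMoment_eq, hermiteMoment_eq]
  have h2 : √(2 : ℝ) ^ j * √(2 : ℝ) ^ j = 2 ^ j := by
    rw [← mul_pow, Real.mul_self_sqrt (by norm_num)]
  have h3 : √(2 * Real.pi) * √(2 * Real.pi) = 2 * Real.pi := Real.mul_self_sqrt (by positivity)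
  have h4 : √(2 ^ j * (j.factorial : ℝ) * √Real.pi) * √(2 ^ j * (j.factorial : ℝ) * √Real.pi) =
    2 ^ j * (j.factorial : ℝ) * √Real.pi := Real.mul_self_sqrt (by positivity)
  have h5 : Complex.exp (-((x : ℂ) ^ 2 + (y : ℂ) ^ 2) / 2) =
      ((Real.exp (-(x ^ 2) / 2) * Real.exp (-(y ^ 2) / 2) : ℝ) : ℂ) := by
    rw [← Real.exp_add]; push_cast; congr 1; ring
  rw [h5, ← Complex.ofReal_natCast, ← Complex.ofReal_one]
  simp only [← Complex.ofReal_mul, ← Complex.ofReal_div]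
  congr 1
  simp only [psi, hermiteH]
  set p := Polynomial.aeval (√2 * x) (Polynomial.hermite j)
  set q := Polynomial.aeval (√2 * y) (Polynomial.hermite j)
  set N := √(2 ^ j * (j.factorial : ℝ) * √Real.pi)
  calc _ = 1 / (N * N) * (√(2 : ℝ) ^ j * √(2 : ℝ) ^ j) * p * q *
        (Real.exp (-(x ^ 2) / 2) * Real.exp (-(y ^ 2) / 2)) := by
          rw [← one_div_mul_one_div]; ring
    _ = 1 / √Real.pi * (1 / (2 * Real.pi)) *
        (Real.exp (-(x ^ 2) / 2) * Real.exp (-(y ^ 2) / 2)) *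
        (1 / (j.factorial : ℝ) * ((√(2 * Real.pi) * √(2 * Real.pi)) * (p * q))) := by
      rw [h2, h3, h4]
      field_simp
    _ = _ := by ring

/-- Mehler's kernel for the harmonic oscillator. -/
def mehler (w : ℂ) (x y : ℝ) : ℂ :=
  (1 / √Real.pi : ℝ) * (1 / (1 - w ^ 2)) ^ (1 / 2 : ℂ) *
    Complex.exp (-((1 - w) / (1 + w)) * (x + y) ^ 2 / 4 - (1 + w) / (1 - w) * (x - y) ^ 2 / 4)

theorem hasSum_mehler {w : ℂ} (hw : ‖w‖ < 1) (x y : ℝ) :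
    HasSum (fun j : ℕ => ((psi j x * psi j y : ℝ) : ℂ) * w ^ j) (mehler w x y) := by
  have h := (hasSum_hermiteMoment_mul hw (√2 * x) (√2 * y)).mul_left
    (((1 / √Real.pi * (1 / (2 * Real.pi)) : ℝ) : ℂ) *
      Complex.exp (-((x : ℂ) ^ 2 + (y : ℂ) ^ 2) / 2))
  rw [integral_mehlerIntegrand hw] at h
  have hre := one_sub_sq_re_pos hw
  have hne : (1 - w ^ 2) ≠ 0 := fun h => by simp [h] at hre
  have hm : 1 - w ≠ 0 := fun h => hne (by linear_combination (1 + w) * h)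
  have hp : 1 + w ≠ 0 := fun h => hne (by linear_combination (1 - w) * h)
  have hs : ((√2 : ℝ) : ℂ) ^ 2 = 2 := by
    rw [← Complex.ofReal_pow, Real.sq_sqrt (by norm_num)]; norm_num
  have hexp : -((x : ℂ) ^ 2 + (y : ℂ) ^ 2) / 2 +
      (2 * w * (√2 * x : ℝ) * (√2 * y : ℝ) - w ^ 2 * ((√2 * x : ℝ) ^ 2 + (√2 * y : ℝ) ^ 2)) /
        (2 * (1 - w ^ 2)) =
      -((1 - w) / (1 + w)) * (x + y) ^ 2 / 4 - (1 + w) / (1 - w) * (x - y) ^ 2 / 4 := by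
    have h1 : (2 * w * (√2 * x : ℝ) * (√2 * y : ℝ) -
        w ^ 2 * ((√2 * x : ℝ) ^ 2 + (√2 * y : ℝ) ^ 2) : ℂ) =
        2 * (2 * w * x * y - w ^ 2 * (x ^ 2 + y ^ 2)) := by
      push_cast
      linear_combination (2 * w * x * y - w ^ 2 * (x ^ 2 + y ^ 2)) * hs
    rw [h1, show 1 - w ^ 2 = (1 - w) * (1 + w) by ring]
    field_simp
    ring
  have hval : mehler w x y = ((1 / √Real.pi * (1 / (2 * Real.pi)) : ℝ) : ℂ) *
      Complex.exp (-((x : ℂ) ^ 2 + (y : ℂ) ^ 2) / 2) *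
      ((2 * Real.pi : ℝ) * (1 / (1 - w ^ 2)) ^ (1 / 2 : ℂ) *
        Complex.exp ((2 * w * (√2 * x : ℝ) * (√2 * y : ℝ) -
          w ^ 2 * ((√2 * x : ℝ) ^ 2 + (√2 * y : ℝ) ^ 2)) / (2 * (1 - w ^ 2)))) := by
    have hpi : ((1 / (2 * Real.pi) : ℝ) : ℂ) * ((2 * Real.pi : ℝ) : ℂ) = 1 := by
      rw [← Complex.ofReal_mul, one_div_mul_cancel (by positivity), Complex.ofReal_one]
    rw [mehler, ← hexp, Complex.exp_add, Complex.ofReal_mul (1 / √Real.pi)]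
    linear_combination (-((1 / √Real.pi : ℝ) : ℂ) * (1 / (1 - w ^ 2)) ^ (1 / 2 : ℂ) *
      (Complex.exp (-((x : ℂ) ^ 2 + (y : ℂ) ^ 2) / 2) *
        Complex.exp ((2 * w * (√2 * x : ℝ) * (√2 * y : ℝ) -
          w ^ 2 * ((√2 * x : ℝ) ^ 2 + (√2 * y : ℝ) ^ 2)) / (2 * (1 - w ^ 2))))) * hpi
  rw [hval]
  refine h.congr_fun fun j => ?_
  rw [psi_mul_psi]
  ring

/-! ### The kernel as a power series coefficient and a Fourier integral -/

theorem hasSum_coeff_mul {p q : PowerSeries ℂ} {w P Q : ℂ}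
    (hp : HasSum (fun m => PowerSeries.coeff m p * w ^ m) P)
    (hq : HasSum (fun m => PowerSeries.coeff m q * w ^ m) Q) :
    HasSum (fun m => PowerSeries.coeff m (p * q) * w ^ m) (P * Q) := by
  have hp' := hp.summable.norm
  have hq' := hq.summable.norm
  have h := tsum_mul_tsum_eq_tsum_sum_antidiagonal_of_summable_norm hp' hq'
  have hs := (summable_norm_sum_mul_antidiagonal_of_summable_norm hp' hq').of_norm.hasSum
  rw [← h, hp.tsum_eq, hq.tsum_eq] at hs
  refine hs.congr_fun fun m => ?_
  rw [PowerSeries.coeff_mul, Finset.sum_mul]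
  refine Finset.sum_congr rfl fun kl hkl => ?_
  rw [← Finset.HasAntidiagonal.mem_antidiagonal.1 hkl, pow_add]
  ring

theorem hasSum_coeff_prod {ι : Type*} (s : Finset ι) {p : ι → PowerSeries ℂ} {w : ℂ} {P : ι → ℂ}
    (hp : ∀ k, HasSum (fun m => PowerSeries.coeff m (p k) * w ^ m) (P k)) :
    HasSum (fun m => PowerSeries.coeff m (∏ k ∈ s, p k) * w ^ m) (∏ k ∈ s, P k) := by
  classical
  induction s using Finset.induction_on with
  | empty =>
    have h := hasSum_single (f := fun m => PowerSeries.coeff m (1 : PowerSeries ℂ) * w ^ m) 0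
      (fun m hm => by simp [PowerSeries.coeff_one, hm])
    simpa using h
  | insert k s hk ih =>
    rw [Finset.prod_insert hk, Finset.prod_insert hk]
    exact hasSum_coeff_mul (hp k) ih

/-- The `m`-th coefficient of the product over `k` sums over `|j| = m`; multiplication by the
geometric series takes partial sums over `m ≤ n`. -/
theorem fermiKernel_eq_coeff (d n : ℕ) (x y : EuclideanSpace ℝ (Fin d)) :
    ((fermiKernel d (n + 1) x y : ℝ) : ℂ) = PowerSeries.coeff n
      ((∏ k : Fin d, PowerSeries.mk fun j => ((psi j (x k) * psi j (y k) : ℝ) : ℂ)) *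
        PowerSeries.mk fun _ => (1 : ℂ)) := by
  rw [PowerSeries.coeff_mul, Finset.Nat.sum_antidiagonal_eq_sum_range_succ_mk]
  simp only [PowerSeries.coeff_mk, mul_one, PowerSeries.coeff_prod]
  rw [fermiKernel, ← Finset.sum_fiberwise_of_maps_to (t := Finset.range (n + 1))
    (g := fun j : Fin d → ℕ => ∑ k, j k)
    (fun j hj => Finset.mem_range.2 ((mem_multiIndices j).1 hj)), Complex.ofReal_sum]
  refine Finset.sum_congr rfl fun m hm => ?_
  rw [Complex.ofReal_sum]
  refine Finset.sum_bij' (fun j _ => Finsupp.equivFunOnFinite.symm j) (fun l _ => l) ?_ ?_ ?_ ?_ ?_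
  · intro j hj
    simp only [Finset.mem_filter] at hj
    simp [Finset.mem_finsuppAntidiag, hj.2]
  · intro l hl
    simp only [Finset.mem_finsuppAntidiag] at hl
    simp only [Finset.mem_filter, mem_multiIndices]
    exact ⟨by rw [hl.1]; exact Finset.mem_range.1 hm, hl.1⟩
  · intro j _; rfl
  · intro l _; ext; rfl
  · intro j _
    simp only [Psi, ← Finset.prod_mul_distrib, Complex.ofReal_prod]
    rfl

theorem integral_exp_int_mul {k : ℤ} (hk : k ≠ 0) :
    ∫ θ in -Real.pi..Real.pi, Complex.exp (k * I * θ) = 0 := by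
  have hc : (k : ℂ) * I ≠ 0 := mul_ne_zero (Int.cast_ne_zero.2 hk) Complex.I_ne_zero
  rw [integral_exp_mul_complex hc]
  have h : Complex.exp (k * I * (Real.pi : ℝ)) = Complex.exp (k * I * (-Real.pi : ℝ)) := by
    rw [Complex.exp_eq_exp_iff_exists_int]
    exact ⟨k, by push_cast; ring⟩
  rw [h, sub_self, zero_div]

theorem coeff_eq_integral {c : ℕ → ℂ} {F : ℝ → ℂ} {a : ℝ}
    (hF : ∀ θ : ℝ, HasSum (fun m => c m * Complex.exp (-(a + θ * I)) ^ m) (F θ)) (N : ℕ) :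
    (2 * Real.pi : ℂ) * c N =
      ∫ θ in -Real.pi..Real.pi, F θ * Complex.exp (N * (a + θ * I)) := by
  have hnorm : ∀ (m : ℕ) (θ : ℝ), ‖c m * Complex.exp (-(a + θ * I)) ^ m‖ =
      ‖c m‖ * Real.exp (-a) ^ m := by
    intro m θ
    rw [norm_mul, norm_pow, Complex.norm_exp]
    simp
  have hN : ∀ θ : ℝ, ‖Complex.exp (N * (a + θ * I))‖ = Real.exp (N * a) := by
    intro θ
    rw [Complex.norm_exp]
    simp
  -- The norms of the terms do not depend on `θ`, so convergence at the single point `θ = 0`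
  -- dominates on the whole circle.
  have hsum : Summable fun m => ‖c m‖ * Real.exp (-a) ^ m :=
    (hF 0).summable.norm.congr fun m => hnorm m 0
  have key := intervalIntegral.hasSum_integral_of_dominated_convergence
    (μ := volume) (a := -Real.pi) (b := Real.pi)
    (F := fun m (θ : ℝ) => c m * Complex.exp (-(a + θ * I)) ^ m * Complex.exp (N * (a + θ * I)))
    (f := fun θ => F θ * Complex.exp (N * (a + θ * I)))
    (fun m _ => ‖c m‖ * Real.exp (-a) ^ m * Real.exp (N * a))
    (fun m => Continuous.aestronglyMeasurable (by fun_prop))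
    (fun m => Eventually.of_forall fun θ _ => by rw [norm_mul, hnorm, hN])
    (Eventually.of_forall fun θ _ => hsum.mul_right _) ?_
    (Eventually.of_forall fun θ _ => (hF θ).mul_right _)
  · have hterm : ∀ m : ℕ, (∫ θ in -Real.pi..Real.pi,
        c m * Complex.exp (-(a + θ * I)) ^ m * Complex.exp (N * (a + θ * I))) =
        if m = N then (2 * Real.pi : ℂ) * c N else 0 := by
      intro m
      have h : ∀ θ : ℝ, c m * Complex.exp (-(a + θ * I)) ^ m * Complex.exp (N * (a + θ * I)) =
          (c m * Complex.exp ((N - m) * a)) * Complex.exp (((N - m : ℤ) : ℂ) * I * θ) := by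
        intro θ
        rw [← Complex.exp_nat_mul, mul_assoc, mul_assoc, ← Complex.exp_add, ← Complex.exp_add]
        congr 2
        push_cast
        ring
      simp_rw [h]
      rw [intervalIntegral.integral_const_mul]
      split_ifs with hm
      · subst hm
        simp
        ring
      · rw [integral_exp_int_mul (by omega), mul_zero]
    simp_rw [hterm] at key
    exact (hasSum_ite_eq N _).unique key
  · exact intervalIntegrable_const

/-- `fermiKernel d (n + 1)` as a Fourier coefficient on the circle of radius `exp (-a)`. -/
theorem fermiKernel_eq_integral (d n : ℕ) (x y : EuclideanSpace ℝ (Fin d)) {a : ℝ} (ha : 0 < a) :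
    (2 * Real.pi : ℂ) * ((fermiKernel d (n + 1) x y : ℝ) : ℂ) = ∫ θ in -Real.pi..Real.pi,
      (∏ k : Fin d, mehler (Complex.exp (-(a + θ * I))) (x k) (y k)) *
        (1 - Complex.exp (-(a + θ * I)))⁻¹ * Complex.exp (n * (a + θ * I)) := by
  rw [fermiKernel_eq_coeff]
  refine coeff_eq_integral (c := fun m => PowerSeries.coeff m
    ((∏ k : Fin d, PowerSeries.mk fun j => ((psi j (x k) * psi j (y k) : ℝ) : ℂ)) *
        PowerSeries.mk fun _ => (1 : ℂ))) (fun θ => ?_) n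
  have hw : ‖Complex.exp (-(a + θ * I))‖ < 1 := by
    rw [Complex.norm_exp]
    simpa using ha
  refine hasSum_coeff_mul (hasSum_coeff_prod _ fun k => ?_) ?_
  · simpa only [PowerSeries.coeff_mk] using hasSum_mehler hw (x k) (y k)
  · simpa only [PowerSeries.coeff_mk, one_mul] using hasSum_geometric_of_norm_lt_one hw

/-! ### Estimates for the exponential, the square root and `tanh (t / 2)` -/

/-- The function `tanh (t / 2)`, written in the variable `exp (-t)`. -/
def halfTanh (t : ℂ) : ℂ :=
  (1 - Complex.exp (-t)) / (1 + Complex.exp (-t))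

theorem norm_exp_sub_exp_le {u v : ℂ} {m : ℝ} (hu : u.re ≤ m) (hv : v.re ≤ m) :
    ‖Complex.exp u - Complex.exp v‖ ≤ Real.exp m * ‖u - v‖ := by
  refine (convex_halfSpace_re_le m).norm_image_sub_le_of_norm_hasDerivWithin_le
    (f' := Complex.exp) (fun z _ => (Complex.hasDerivAt_exp z).hasDerivWithinAt) (fun z hz => ?_)
    hv hu
  rw [Complex.norm_exp]
  exact Real.exp_le_exp.2 hz

theorem norm_pow_sub_pow_le {x y : ℂ} (hx : ‖x‖ ≤ 1) (hy : ‖y‖ ≤ 1) (d : ℕ) :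
    ‖x ^ d - y ^ d‖ ≤ d * ‖x - y‖ := by
  induction d with
  | zero => simp
  | succ d ih =>
    have h : x ^ (d + 1) - y ^ (d + 1) = x * (x ^ d - y ^ d) + (x - y) * y ^ d := by ring
    rw [h]
    refine (norm_add_le _ _).trans ?_
    rw [norm_mul, norm_mul, norm_pow]
    have h1 : ‖x‖ * ‖x ^ d - y ^ d‖ ≤ 1 * (d * ‖x - y‖) := by gcongr
    have h2 : ‖x - y‖ * ‖y‖ ^ d ≤ ‖x - y‖ * 1 := by
      gcongr; exact pow_le_one₀ (norm_nonneg _) hy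
    push_cast
    linarith

theorem cpow_half_sq (z : ℂ) : (z ^ (1 / 2 : ℂ)) ^ 2 = z := by
  simp

theorem norm_cpow_half_sq (z : ℂ) : ‖z ^ (1 / 2 : ℂ)‖ ^ 2 = ‖z‖ := by
  rw [← norm_pow, cpow_half_sq]

theorem cpow_half_re_nonneg (z : ℂ) : 0 ≤ (z ^ (1 / 2 : ℂ)).re := by
  have h := Complex.abs_arg_le_pi z
  rw [Complex.cpow_def]
  split_ifs with h1 h2
  · simp
  · simp
  · rw [Complex.exp_re]
    refine mul_nonneg (Real.exp_nonneg _) (Real.cos_nonneg_of_neg_pi_div_two_le_of_le ?_ ?_)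
    all_goals
      have h3 : (Complex.log z * (1 / 2)).im = z.arg / 2 := by
        simp [Complex.mul_im, Complex.log_im]; ring
      rw [h3]
      rw [abs_le] at h
      linarith [h.1, h.2]

/-- For the root `s`, `2 (Re s)² = |z| + Re z ≥ |z| ≥ |z|²`. -/
theorem half_norm_le_cpow_half_re {z : ℂ} (hz : 0 ≤ z.re) (h1 : ‖z‖ ≤ 1) :
    ‖z‖ / 2 ≤ (z ^ (1 / 2 : ℂ)).re := by
  have h0 := cpow_half_re_nonneg z
  have h2 := norm_cpow_half_sq z
  have h3 := congrArg Complex.re (cpow_half_sq z)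
  set s := z ^ (1 / 2 : ℂ)
  rw [← Complex.normSq_eq_norm_sq, Complex.normSq_apply] at h2
  rw [pow_two, Complex.mul_re] at h3
  nlinarith [norm_nonneg z]

theorem norm_cpow_half_le_one {z : ℂ} (h : ‖z‖ ≤ 1) : ‖z ^ (1 / 2 : ℂ)‖ ≤ 1 := by
  rw [← norm_cpow_half_sq] at h
  exact (sq_le_one_iff₀ (norm_nonneg _)).1 h

/-- Divide `u - v` by the sum of the roots. Principal roots have nonnegative real part, so the root
of `u`, with no condition on `u`, cannot cancel that of `v`. -/
theorem norm_cpow_half_sub_le {u v : ℂ} (hv : 0 ≤ v.re) (hv0 : v ≠ 0) (hv1 : ‖v‖ ≤ 1) :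
    ‖u ^ (1 / 2 : ℂ) - v ^ (1 / 2 : ℂ)‖ ≤ 2 / ‖v‖ * ‖u - v‖ := by
  have h0 := cpow_half_re_nonneg u
  have h1 := half_norm_le_cpow_half_re hv hv1
  have h2 : (u ^ (1 / 2 : ℂ) - v ^ (1 / 2 : ℂ)) * (u ^ (1 / 2 : ℂ) + v ^ (1 / 2 : ℂ)) = u - v := by
    linear_combination cpow_half_sq u - cpow_half_sq v
  have h3 : ‖v‖ / 2 ≤ ‖u ^ (1 / 2 : ℂ) + v ^ (1 / 2 : ℂ)‖ := by
    refine le_trans ?_ (Complex.re_le_norm _)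
    rw [Complex.add_re]; linarith
  have hvp : 0 < ‖v‖ := norm_pos_iff.2 hv0
  rw [← h2, norm_mul, div_mul_eq_mul_div, le_div_iff₀ hvp]
  nlinarith [norm_nonneg (u ^ (1 / 2 : ℂ) - v ^ (1 / 2 : ℂ))]

theorem one_le_norm_one_add_exp_neg {t : ℂ} (ht : ‖t‖ ≤ 1 / 2) :
    1 ≤ ‖1 + Complex.exp (-t)‖ := by
  have h := Complex.norm_exp_sub_one_le (x := -t) (by rw [norm_neg]; linarith)
  rw [norm_neg] at h
  have h2 := norm_sub_le (1 + Complex.exp (-t)) (Complex.exp (-t) - 1)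
  rw [show 1 + Complex.exp (-t) - (Complex.exp (-t) - 1) = 2 by ring, Complex.norm_ofNat] at h2
  linarith

/-- Multiplying by `1 + exp (-t)`, of norm at least `1`, leaves only terms of order four and higher.
The true error is of order five, but order four is enough: against the prefactor `8 / a³` of the
phase it leaves one factor `a`. -/
theorem norm_halfTanh_sub_cubic_le {t : ℂ} (ht : ‖t‖ ≤ 1 / 2) :
    ‖halfTanh t - (t / 2 - t ^ 3 / 24)‖ ≤ ‖t‖ ^ 4 / 4 := by
  have h1 := one_le_norm_one_add_exp_neg ht
  have hR := Complex.exp_bound (x := -t) (by rw [norm_neg]; linarith) (n := 4) (by norm_num)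
  set R := Complex.exp (-t) - ∑ m ∈ Finset.range 4, (-t) ^ m / (m.factorial : ℂ) with hRdef
  have hexp : Complex.exp (-t) = 1 - t + t ^ 2 / 2 - t ^ 3 / 6 + R := by
    rw [hRdef]
    simp [Finset.sum_range_succ, Nat.factorial]
    ring
  have hR' : ‖R‖ ≤ ‖t‖ ^ 4 * (5 / 96) := by
    rw [norm_neg] at hR
    refine hR.trans_eq ?_
    norm_num [Nat.factorial]
  have hne : 1 + Complex.exp (-t) ≠ 0 := fun h => by rw [h, norm_zero] at h1; linarith
  have hnum : (halfTanh t - (t / 2 - t ^ 3 / 24)) * (1 + Complex.exp (-t)) =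
      -R + t ^ 4 / 24 + t ^ 5 / 48 - t ^ 6 / 144 - R * (t / 2) + R * (t ^ 3 / 24) := by
    rw [sub_mul, halfTanh, div_mul_cancel₀ _ hne, hexp]
    ring
  have hle : ‖halfTanh t - (t / 2 - t ^ 3 / 24)‖ ≤
      ‖-R + t ^ 4 / 24 + t ^ 5 / 48 - t ^ 6 / 144 - R * (t / 2) + R * (t ^ 3 / 24)‖ := by
    rw [← hnum, norm_mul]
    exact le_mul_of_one_le_right (norm_nonneg _) h1
  refine hle.trans ?_
  have h5 : ‖t‖ ^ 5 ≤ ‖t‖ ^ 4 * (1 / 2) := by rw [pow_succ]; gcongr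
  have h6 : ‖t‖ ^ 6 ≤ ‖t‖ ^ 4 * (1 / 4) := by
    rw [show ‖t‖ ^ 6 = ‖t‖ ^ 4 * ‖t‖ ^ 2 by ring]
    gcongr
    nlinarith [norm_nonneg t]
  have h3 : ‖t‖ ^ 3 ≤ 1 / 8 := by
    calc ‖t‖ ^ 3 ≤ (1 / 2) ^ 3 := by gcongr
      _ = 1 / 8 := by norm_num
  have hRt : ‖R‖ * ‖t‖ ≤ ‖t‖ ^ 4 * (5 / 96) * (1 / 2) := by gcongr
  have hRt3 : ‖R‖ * ‖t‖ ^ 3 ≤ ‖t‖ ^ 4 * (5 / 96) * (1 / 8) := by gcongr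
  have htri : ‖-R + t ^ 4 / 24 + t ^ 5 / 48 - t ^ 6 / 144 - R * (t / 2) + R * (t ^ 3 / 24)‖ ≤
      ‖R‖ + ‖t‖ ^ 4 / 24 + ‖t‖ ^ 5 / 48 + ‖t‖ ^ 6 / 144 + ‖R‖ * (‖t‖ / 2) +
        ‖R‖ * (‖t‖ ^ 3 / 24) := by
    refine (norm_add_le _ _).trans (add_le_add ?_ (by simp))
    refine (norm_sub_le _ _).trans (add_le_add ?_ (by simp))
    refine (norm_sub_le _ _).trans (add_le_add ?_ (by simp))
    refine (norm_add_le _ _).trans (add_le_add ?_ (by simp))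
    refine (norm_add_le _ _).trans (add_le_add (by simp) (by simp))
  have h4 : 0 ≤ ‖t‖ ^ 4 := by positivity
  linarith

theorem norm_halfTanh_sub_le {t : ℂ} (ht : ‖t‖ ≤ 1 / 2) :
    ‖halfTanh t - t / 2‖ ≤ ‖t‖ ^ 2 / 4 := by
  have h := norm_halfTanh_sub_cubic_le ht
  have h2 : ‖halfTanh t - t / 2‖ ≤ ‖halfTanh t - (t / 2 - t ^ 3 / 24)‖ + ‖t‖ ^ 3 / 24 := by
    have h3 := norm_sub_le (halfTanh t - (t / 2 - t ^ 3 / 24)) (t ^ 3 / 24)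
    rw [show halfTanh t - (t / 2 - t ^ 3 / 24) - t ^ 3 / 24 = halfTanh t - t / 2 by ring] at h3
    simpa using h3
  have h3 : ‖t‖ ^ 3 ≤ ‖t‖ ^ 2 * (1 / 2) := by rw [pow_succ]; gcongr
  have h4 : ‖t‖ ^ 4 ≤ ‖t‖ ^ 2 * (1 / 4) := by
    rw [show ‖t‖ ^ 4 = ‖t‖ ^ 2 * ‖t‖ ^ 2 by ring]
    gcongr
    nlinarith [norm_nonneg t]
  nlinarith [sq_nonneg ‖t‖]

theorem norm_halfTanh_le {t : ℂ} (ht : ‖t‖ ≤ 1 / 2) : ‖halfTanh t‖ ≤ ‖t‖ := by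
  have h := norm_halfTanh_sub_le ht
  have h2 := norm_add_le (halfTanh t - t / 2) (t / 2)
  rw [sub_add_cancel, norm_div, Complex.norm_ofNat] at h2
  nlinarith [norm_nonneg t]

theorem quarter_norm_le_norm_halfTanh {t : ℂ} (ht : ‖t‖ ≤ 1 / 2) :
    ‖t‖ / 4 ≤ ‖halfTanh t‖ := by
  have h := norm_halfTanh_sub_le ht
  have h2 := norm_sub_le (halfTanh t) (halfTanh t - t / 2)
  rw [sub_sub_cancel, norm_div, Complex.norm_ofNat] at h2
  nlinarith [norm_nonneg t]

theorem norm_inv_halfTanh_sub_le {t : ℂ} (ht0 : t ≠ 0) (ht : ‖t‖ ≤ 1 / 2) :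
    ‖1 / halfTanh t - 2 / t‖ ≤ 2 := by
  have h := norm_halfTanh_sub_le ht
  have h2 := quarter_norm_le_norm_halfTanh ht
  have htp : 0 < ‖t‖ := norm_pos_iff.2 ht0
  have hTp : 0 < ‖halfTanh t‖ := by linarith
  have hT0 : halfTanh t ≠ 0 := norm_pos_iff.1 hTp
  have heq : 1 / halfTanh t - 2 / t = -2 * (halfTanh t - t / 2) / (halfTanh t * t) := by
    field_simp
    ring
  rw [heq, norm_div, norm_mul, norm_mul, norm_neg, Complex.norm_ofNat,
    div_le_iff₀ (mul_pos hTp htp)]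
  nlinarith

/-- The half-angle estimate behind the decay along the circle `‖w‖ = exp (-a)`. -/
theorem halfTanh_re_ge {a θ : ℝ} (ha : 0 < a) (ha2 : a ≤ 1 / 2) (hθ : |θ| ≤ Real.pi) :
    (halfTanh a).re * (1 + θ ^ 2 / (2 * Real.pi ^ 2)) ≤ (halfTanh (a + θ * I)).re := by
  set r := Real.exp (-a) with hr
  have hr1 : r < 1 := by rw [hr, Real.exp_lt_one_iff]; linarith
  have hr2 : 1 / 2 ≤ r := by
    have := Real.add_one_le_exp (-a)
    linarith
  have hw0 : Complex.exp (-(a : ℂ)) = (r : ℂ) := by rw [hr]; push_cast; rfl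
  have hT0 : (halfTanh a).re = (1 - r) / (1 + r) := by
    rw [halfTanh, hw0, ← Complex.ofReal_one, ← Complex.ofReal_sub, ← Complex.ofReal_add,
      ← Complex.ofReal_div, Complex.ofReal_re]
  have hre : (Complex.exp (-((a : ℂ) + θ * I))).re = r * Real.cos θ := by
    rw [Complex.exp_re]; simp [hr]
  have him : (Complex.exp (-((a : ℂ) + θ * I))).im = -(r * Real.sin θ) := by
    rw [Complex.exp_im]; simp [hr]
  -- With `w = exp (-(a + i θ))`, the real part is `(1 - |w|²) / |1 + w|²`: only the denominator
  -- depends on `θ`, and it decreases as `w` moves towards `-1`.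
  have hT : (halfTanh (a + θ * I)).re = (1 - r ^ 2) / (1 + 2 * r * Real.cos θ + r ^ 2) := by
    have hsc := Real.sin_sq_add_cos_sq θ
    have hden : Complex.normSq (1 + Complex.exp (-((a : ℂ) + θ * I))) =
        1 + 2 * r * Real.cos θ + r ^ 2 := by
      rw [Complex.normSq_apply, Complex.add_re, Complex.add_im, hre, him, Complex.one_re,
        Complex.one_im]
      linear_combination r ^ 2 * hsc
    rw [halfTanh, Complex.div_re, hden, ← add_div]
    congr 1
    simp only [Complex.add_re, Complex.add_im, Complex.sub_re, Complex.sub_im, hre, him,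
      Complex.one_re, Complex.one_im]
    linear_combination (-r ^ 2) * hsc
  have hcos := Real.cos_le_one_sub_mul_cos_sq hθ
  have hden : 0 < 1 + 2 * r * Real.cos θ + r ^ 2 := by
    nlinarith [Real.neg_one_le_cos θ]
  have hden' : 1 + 2 * r * Real.cos θ + r ^ 2 ≤ (1 + r) ^ 2 - 2 * r * (2 / Real.pi ^ 2 * θ ^ 2) := by
    nlinarith
  rw [hT0, hT, show θ ^ 2 / (2 * Real.pi ^ 2) = 2 / Real.pi ^ 2 * θ ^ 2 / 4 by ring]
  have hx0 : 0 ≤ 2 / Real.pi ^ 2 * θ ^ 2 := by positivity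
  set x := 2 / Real.pi ^ 2 * θ ^ 2
  rw [le_div_iff₀ hden]
  have h1 : (1 - r) / (1 + r) * (1 + x / 4) * (1 + 2 * r * Real.cos θ + r ^ 2) ≤
      (1 - r) / (1 + r) * (1 + x / 4) * ((1 + r) ^ 2 - 2 * r * x) := by
    have : 0 ≤ (1 - r) / (1 + r) := div_nonneg (by linarith) (by linarith)
    gcongr
  refine h1.trans ?_
  -- The coefficient of `x` is nonpositive exactly when `(1 + r)² ≤ 8 r`, which `1 / 2 ≤ r < 1`
  -- ensures.
  have h2 : (1 + x / 4) * ((1 + r) ^ 2 - 2 * r * x) ≤ (1 + r) ^ 2 := by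
    have h3 : 0 ≤ 8 * r - (1 + r) ^ 2 := by nlinarith
    have h4 : 0 ≤ r * x ^ 2 := by positivity
    linarith [mul_nonneg hx0 h3]
  calc _ = (1 - r) / (1 + r) * ((1 + x / 4) * ((1 + r) ^ 2 - 2 * r * x)) := by ring
    _ ≤ (1 - r) / (1 + r) * (1 + r) ^ 2 := by
      have : 0 ≤ (1 - r) / (1 + r) := div_nonneg (by linarith) (by linarith)
      gcongr
    _ = 1 - r ^ 2 := by field_simp; ring

/-! ### The phases on the Airy contour -/

/-- The point `1 + i y` of the vertical line on which the Airy function is defined. -/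
def airyLine (y : ℝ) : ℂ := 1 + y * I

/-- The phase of the finite-`n` kernel, with `a = (4 / n) ^ (1 / 3)`. -/
def finitePhase (a α β δ : ℝ) (t : ℂ) : ℂ :=
  4 / a ^ 3 * (t - 2 * halfTanh t) - α / a * halfTanh t - β * a * halfTanh t -
    δ * a * (1 / halfTanh t)

/-- The phase of the limiting kernel. -/
def limitPhase (α δ : ℝ) (σ : ℂ) : ℂ :=
  σ ^ 3 / 3 - α / 2 * σ - 2 * δ * (1 / σ)

theorem airyLine_re (y : ℝ) : (airyLine y).re = 1 := by simp [airyLine]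

theorem airyLine_im (y : ℝ) : (airyLine y).im = y := by simp [airyLine]

theorem one_le_norm_airyLine (y : ℝ) : 1 ≤ ‖airyLine y‖ := by
  have h := Complex.re_le_norm (airyLine y)
  rwa [airyLine_re] at h

theorem abs_le_norm_airyLine (y : ℝ) : |y| ≤ ‖airyLine y‖ := by
  have h := Complex.abs_im_le_norm (airyLine y)
  rwa [airyLine_im] at h

theorem norm_airyLine_sq (y : ℝ) : ‖airyLine y‖ ^ 2 = 1 + y ^ 2 := by
  rw [← Complex.normSq_eq_norm_sq, Complex.normSq_apply, airyLine_re, airyLine_im]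
  ring

theorem airyLine_ne_zero (y : ℝ) : airyLine y ≠ 0 :=
  norm_pos_iff.1 (lt_of_lt_of_le one_pos (one_le_norm_airyLine y))

theorem ofReal_mul_airyLine (a y : ℝ) : (a : ℂ) * airyLine y = a + (a * y : ℝ) * I := by
  rw [airyLine]; push_cast; ring

theorem norm_ofReal_mul_airyLine {a : ℝ} (ha : 0 < a) (y : ℝ) :
    ‖(a : ℂ) * airyLine y‖ = a * ‖airyLine y‖ := by
  rw [norm_mul, Complex.norm_real, Real.norm_of_nonneg ha.le]

theorem re_one_div_nonneg {z : ℂ} (hz : 0 ≤ z.re) : 0 ≤ (1 / z).re := by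
  rw [one_div, Complex.inv_re]
  exact div_nonneg hz (Complex.normSq_nonneg _)

theorem airyLine_pow_three_div_re (y : ℝ) : (airyLine y ^ 3 / 3).re = 1 / 3 - y ^ 2 := by
  rw [Complex.div_ofNat_re, pow_succ, pow_two, Complex.mul_re, Complex.mul_re, Complex.mul_im,
    airyLine_re, airyLine_im]
  ring

/-- The cubic gives the decay `-y²`; the weaker rate `1 / (2 π²)` is the one available for
`finitePhase`, so that one Gaussian serves both. -/
theorem limitPhase_re_le {M α δ : ℝ} (hα : |α| ≤ M) (hδ : 0 ≤ δ) (y : ℝ) :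
    (limitPhase α δ (airyLine y)).re ≤ 4 / 3 + M - y ^ 2 / (2 * Real.pi ^ 2) := by
  have h1 := re_one_div_nonneg (z := airyLine y) (by rw [airyLine_re]; norm_num)
  have h2 : (limitPhase α δ (airyLine y)).re =
      1 / 3 - y ^ 2 - α / 2 - 2 * δ * (1 / airyLine y).re := by
    have e1 : ((α : ℂ) / 2 * airyLine y).re = α / 2 := by
      rw [show (α : ℂ) / 2 = ((α / 2 : ℝ) : ℂ) by push_cast; rfl, Complex.re_ofReal_mul,
        airyLine_re, mul_one]
    have e2 : (2 * (δ : ℂ) * (1 / airyLine y)).re = 2 * δ * (1 / airyLine y).re := by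
      rw [show 2 * (δ : ℂ) = ((2 * δ : ℝ) : ℂ) by push_cast; rfl, Complex.re_ofReal_mul]
    rw [limitPhase, Complex.sub_re, Complex.sub_re, airyLine_pow_three_div_re, e1, e2]
  have h3 : y ^ 2 / (2 * Real.pi ^ 2) ≤ y ^ 2 := by
    refine div_le_self (sq_nonneg y) ?_
    nlinarith [Real.pi_gt_three]
  have h4 : 0 ≤ 2 * δ * (1 / airyLine y).re := by positivity
  rw [h2]
  linarith [(abs_le.1 hα).1, abs_nonneg α]

/-- The terms in `β` and `δ` only lower the real part. The rest decreases in `Re tanh` with slope at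
least `8 / a³ - M / a ≥ 4 / a³`, by `haM`. Inserting the lower bound of `halfTanh_re_ge`, its value
at `θ = 0` gives the constant `4 / 3 + M`, and its growth gives at least `4 / a³ * (a / 4) * a² x =
x` with `x = y² / (2 π²)`. -/
theorem finitePhase_re_le {M a α β δ : ℝ} (ha : 0 < a) (ha2 : a ≤ 1 / 2) (haM : M * a ^ 2 ≤ 4)
    (hα : |α| ≤ M) (hβ : 0 ≤ β) (hδ : 0 ≤ δ) {y : ℝ} (hy : |a * y| ≤ Real.pi) :
    (finitePhase a α β δ (a * airyLine y)).re ≤ 4 / 3 + M - y ^ 2 / (2 * Real.pi ^ 2) := by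
  have hna : ‖(a : ℂ)‖ = a := by rw [Complex.norm_real, Real.norm_of_nonneg ha.le]
  have hna2 : ‖(a : ℂ)‖ ≤ 1 / 2 := by rw [hna]; exact ha2
  have hcub := norm_halfTanh_sub_cubic_le hna2
  have hlin := norm_halfTanh_sub_le hna2
  have hge := halfTanh_re_ge ha ha2 hy
  rw [← ofReal_mul_airyLine] at hge
  rw [hna] at hcub hlin
  have hcub' := (Complex.abs_re_le_norm _).trans hcub
  have hlin' := (Complex.abs_re_le_norm _).trans hlin
  rw [Complex.sub_re, show (a : ℂ) / 2 - (a : ℂ) ^ 3 / 24 = ((a / 2 - a ^ 3 / 24 : ℝ) : ℂ) by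
    push_cast; rfl, Complex.ofReal_re] at hcub'
  rw [Complex.sub_re, show (a : ℂ) / 2 = ((a / 2 : ℝ) : ℂ) by push_cast; rfl,
    Complex.ofReal_re] at hlin'
  set T₀ := (halfTanh a).re
  set T := halfTanh (a * airyLine y)
  rw [abs_le] at hcub' hlin'
  have hT0a : T₀ ≤ a := by nlinarith
  have hT0b : a / 4 ≤ T₀ := by nlinarith
  have hx0 : 0 ≤ y ^ 2 / (2 * Real.pi ^ 2) := by positivity
  have hge' : T₀ * (1 + a ^ 2 * (y ^ 2 / (2 * Real.pi ^ 2))) ≤ T.re := by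
    refine le_trans (le_of_eq ?_) hge
    ring
  set x := y ^ 2 / (2 * Real.pi ^ 2)
  have hT0 : 0 ≤ T₀ := le_trans (by positivity) hT0b
  have hTre : 0 ≤ T.re := le_trans (by positivity) hge'
  have hTinv := re_one_div_nonneg hTre
  have hre : (finitePhase a α β δ (a * airyLine y)).re =
      4 / a ^ 3 * (a - 2 * T.re) - α / a * T.re - β * a * T.re - δ * a * (1 / T).re := by
    have e : finitePhase a α β δ (a * airyLine y) =
        ((4 / a ^ 3 : ℝ) : ℂ) * (a * airyLine y - (2 : ℝ) * T) - ((α / a : ℝ) : ℂ) * T -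
          ((β * a : ℝ) : ℂ) * T - ((δ * a : ℝ) : ℂ) * (1 / T) := by
      rw [finitePhase]; push_cast; rfl
    rw [e]
    simp only [Complex.sub_re, Complex.re_ofReal_mul, airyLine_re, mul_one]
  have h1 : -(α / a * T.re) ≤ M / a * T.re := by
    rw [← neg_mul, ← neg_div]
    gcongr
    linarith [(abs_le.1 hα).1]
  have h2 : 0 ≤ β * a * T.re := by positivity
  have h3 : 0 ≤ δ * a * (1 / T).re := by positivity
  have h4 : 4 / a ^ 3 ≤ 8 / a ^ 3 - M / a := by
    rw [show M / a = M * a ^ 2 / a ^ 3 by field_simp]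
    rw [← sub_div]
    gcongr
    linarith
  have ha3 : 0 < 4 / a ^ 3 := by positivity
  have ha4 : 0 ≤ 8 / a ^ 3 - M / a := ha3.le.trans h4
  have h5 : (8 / a ^ 3 - M / a) * (T₀ * (1 + a ^ 2 * x)) ≤ (8 / a ^ 3 - M / a) * T.re :=
    mul_le_mul_of_nonneg_left hge' ha4
  have h6 : x ≤ (8 / a ^ 3 - M / a) * (T₀ * (a ^ 2 * x)) := by
    calc x = 4 / a ^ 3 * (a / 4 * (a ^ 2 * x)) := by field_simp
      _ ≤ _ := by gcongr
  have h7 : 4 / a ^ 3 * (a - 2 * T₀) ≤ 4 / 3 := by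
    have : a - 2 * T₀ ≤ a ^ 3 / 12 + a ^ 4 / 2 := by linarith
    calc 4 / a ^ 3 * (a - 2 * T₀) ≤ 4 / a ^ 3 * (a ^ 3 / 12 + a ^ 4 / 2) := by gcongr
      _ = 1 / 3 + 2 * a := by field_simp; ring
      _ ≤ 4 / 3 := by linarith
  have h8 : M / a * T₀ ≤ M := by
    have hM : 0 ≤ M := (abs_nonneg α).trans hα
    calc M / a * T₀ ≤ M / a * a := by gcongr
      _ = M := by field_simp
  rw [hre]
  have e1 : 4 / a ^ 3 * (a - 2 * T.re) + M / a * T.re =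
      4 / a ^ 3 * a - (8 / a ^ 3 - M / a) * T.re := by ring
  have e2 : 4 / a ^ 3 * a - (8 / a ^ 3 - M / a) * (T₀ * (1 + a ^ 2 * x)) =
      4 / a ^ 3 * (a - 2 * T₀) + M / a * T₀ - (8 / a ^ 3 - M / a) * (T₀ * (a ^ 2 * x)) := by ring
  linarith

/-- Each prefactor meets an expansion of matching order: `a⁻³` the cubic one, `a⁻¹` the linear one,
`δ a` the pole of `coth`, while the `β` term is itself an error. Since `|σ| ≥ 1`, all powers of
`|σ|` are raised to the fourth. -/
theorem norm_finitePhase_sub_limitPhase_le {M a α β δ : ℝ} (ha : 0 < a) (hα : |α| ≤ M)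
    (hβ : |β| ≤ M) (hδ : |δ| ≤ M) {y : ℝ} (hy : ‖(a : ℂ) * airyLine y‖ ≤ 1 / 2) :
    ‖finitePhase a α β δ (a * airyLine y) - limitPhase α δ (airyLine y)‖ ≤
      (2 + 4 * M) * a * ‖airyLine y‖ ^ 4 := by
  have h1 := norm_halfTanh_sub_cubic_le hy
  have h2 := norm_halfTanh_sub_le hy
  have h3 := norm_halfTanh_le hy
  have hac : (a : ℂ) ≠ 0 := Complex.ofReal_ne_zero.2 ha.ne'
  have h4 := norm_inv_halfTanh_sub_le (mul_ne_zero hac (airyLine_ne_zero y)) hy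
  have hs := one_le_norm_airyLine y
  have hs0 := airyLine_ne_zero y
  have hna := norm_ofReal_mul_airyLine ha y
  have hnac : ‖(a : ℂ)‖ = a := by rw [Complex.norm_real, Real.norm_of_nonneg ha.le]
  set σ := airyLine y
  set t := (a : ℂ) * σ with ht
  have heq : finitePhase a α β δ t - limitPhase α δ σ =
      -(8 / a ^ 3 * (halfTanh t - (t / 2 - t ^ 3 / 24))) - α / a * (halfTanh t - t / 2) -
        β * a * halfTanh t - δ * a * (1 / halfTanh t - 2 / t) := by
    have e1 : σ ^ 3 / 3 = 4 / (a : ℂ) ^ 3 * (t ^ 3 / 12) := by rw [ht]; field_simp; ring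
    have e2 : (α : ℂ) / 2 * σ = α / a * (t / 2) := by rw [ht]; field_simp
    have e3 : 2 * (δ : ℂ) * (1 / σ) = δ * a * (2 / t) := by rw [ht]; field_simp
    rw [finitePhase, limitPhase, e1, e2, e3]
    ring
  have hM : 0 ≤ M := (abs_nonneg α).trans hα
  have b1 : ‖8 / (a : ℂ) ^ 3 * (halfTanh t - (t / 2 - t ^ 3 / 24))‖ ≤ 2 * a * ‖σ‖ ^ 4 := by
    rw [norm_mul, norm_div, norm_pow, hnac, Complex.norm_ofNat]
    calc _ ≤ 8 / a ^ 3 * (‖t‖ ^ 4 / 4) := by gcongr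
      _ = 2 * a * ‖σ‖ ^ 4 := by rw [hna]; field_simp; ring
  have b2 : ‖(α : ℂ) / a * (halfTanh t - t / 2)‖ ≤ M * a * ‖σ‖ ^ 4 := by
    rw [norm_mul, norm_div, hnac, Complex.norm_real, Real.norm_eq_abs]
    calc _ ≤ M / a * (‖t‖ ^ 2 / 4) := by gcongr
      _ = M * a * (‖σ‖ ^ 2 / 4) := by rw [hna]; field_simp
      _ ≤ M * a * ‖σ‖ ^ 4 := by gcongr; nlinarith [one_le_pow₀ hs (n := 2)]
  have b3 : ‖(β : ℂ) * a * halfTanh t‖ ≤ M * a * ‖σ‖ ^ 4 := by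
    rw [norm_mul, norm_mul, hnac, Complex.norm_real, Real.norm_eq_abs]
    have : ‖halfTanh t‖ ≤ ‖σ‖ ^ 4 := by
      linarith [one_le_pow₀ hs (n := 4)]
    gcongr
  have b4 : ‖(δ : ℂ) * a * (1 / halfTanh t - 2 / t)‖ ≤ 2 * M * a * ‖σ‖ ^ 4 := by
    rw [norm_mul, norm_mul, hnac, Complex.norm_real, Real.norm_eq_abs]
    calc _ ≤ M * a * 2 := by gcongr
      _ ≤ M * a * (2 * ‖σ‖ ^ 4) := by gcongr; linarith [one_le_pow₀ hs (n := 4)]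
      _ = _ := by ring
  rw [heq]
  refine (norm_sub_le _ _).trans ?_
  refine (add_le_add (norm_sub_le _ _) le_rfl).trans ?_
  refine (add_le_add (add_le_add (norm_sub_le _ _) le_rfl) le_rfl).trans ?_
  rw [norm_neg]
  linarith

/-! ### The amplitudes -/

/-- The amplitude that multiplies `exp (finitePhase ..)`. -/
def finiteAmplitude (d : ℕ) (a : ℝ) (t : ℂ) : ℂ :=
  ((a / (1 - Complex.exp (-t) ^ 2)) ^ (1 / 2 : ℂ)) ^ d * (a / (Complex.exp t - 1))

/-- The amplitude that multiplies `exp (limitPhase ..)`. -/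
def limitAmplitude (d : ℕ) (σ : ℂ) : ℂ :=
  ((1 / (2 * σ)) ^ (1 / 2 : ℂ)) ^ d * (1 / σ)

theorem le_norm_one_sub_exp_neg_sq {a : ℝ} (ha : 0 < a) (ha2 : a ≤ 1 / 2) (y : ℝ) :
    a ≤ ‖1 - Complex.exp (-((a : ℂ) * airyLine y)) ^ 2‖ := by
  have h1 : ‖Complex.exp (-((a : ℂ) * airyLine y)) ^ 2‖ = Real.exp (-(2 * a)) := by
    rw [norm_pow, Complex.norm_exp, Complex.neg_re, Complex.re_ofReal_mul, airyLine_re,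
      ← Real.exp_nat_mul]
    congr 1; push_cast; ring
  have h2 := norm_sub_norm_le 1 (Complex.exp (-((a : ℂ) * airyLine y)) ^ 2)
  rw [h1, norm_one] at h2
  -- From `exp (2 a) ≥ 1 + 2 a` and `(1 + 2 a) (1 - a) ≥ 1`, the latter because `a ≤ 1 / 2`.
  have h3 : Real.exp (-(2 * a)) ≤ 1 - a := by
    have h4 := Real.add_one_le_exp (2 * a)
    rw [Real.exp_neg]
    refine inv_le_of_inv_le₀ (by linarith) ?_
    refine le_trans ?_ h4
    rw [inv_le_comm₀ (by linarith) (by linarith), inv_le_iff_one_le_mul₀ (by linarith)]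
    nlinarith
  linarith

theorem le_norm_exp_sub_one {a : ℝ} (y : ℝ) :
    a ≤ ‖Complex.exp ((a : ℂ) * airyLine y) - 1‖ := by
  have h1 : ‖Complex.exp ((a : ℂ) * airyLine y)‖ = Real.exp a := by
    rw [Complex.norm_exp, Complex.re_ofReal_mul, airyLine_re, mul_one]
  have h2 := norm_sub_norm_le (Complex.exp ((a : ℂ) * airyLine y)) 1
  rw [h1, norm_one] at h2
  linarith [Real.add_one_le_exp a]

theorem norm_ofReal_div_le_one {a : ℝ} (ha : 0 < a) {z : ℂ} (hz : a ≤ ‖z‖) :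
    ‖(a : ℂ) / z‖ ≤ 1 := by
  rw [norm_div, Complex.norm_real, Real.norm_of_nonneg ha.le]
  exact div_le_one_of_le₀ hz (norm_nonneg z)

theorem norm_finiteAmplitude_le {a : ℝ} (ha : 0 < a) (ha2 : a ≤ 1 / 2) (d : ℕ) (y : ℝ) :
    ‖finiteAmplitude d a (a * airyLine y)‖ ≤ 1 := by
  rw [finiteAmplitude, norm_mul, norm_pow]
  refine mul_le_one₀ (pow_le_one₀ (norm_nonneg _) (norm_cpow_half_le_one ?_)) (norm_nonneg _) ?_
  · exact norm_ofReal_div_le_one ha (le_norm_one_sub_exp_neg_sq ha ha2 y)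
  · exact norm_ofReal_div_le_one ha (le_norm_exp_sub_one y)

theorem norm_one_div_airyLine_le (y : ℝ) : ‖1 / airyLine y‖ ≤ 1 := by
  rw [norm_div, norm_one]
  exact div_le_one_of_le₀ (one_le_norm_airyLine y) (norm_nonneg _)

theorem norm_one_div_two_mul_airyLine_le (y : ℝ) : ‖1 / (2 * airyLine y)‖ ≤ 1 := by
  rw [norm_div, norm_one, norm_mul, Complex.norm_ofNat]
  exact div_le_one_of_le₀ (by linarith [one_le_norm_airyLine y]) (by positivity)

theorem norm_limitAmplitude_le (d : ℕ) (y : ℝ) : ‖limitAmplitude d (airyLine y)‖ ≤ 1 := by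
  rw [limitAmplitude, norm_mul, norm_pow]
  exact mul_le_one₀ (pow_le_one₀ (norm_nonneg _) (norm_cpow_half_le_one
    (norm_one_div_two_mul_airyLine_le y))) (norm_nonneg _) (norm_one_div_airyLine_le y)

theorem norm_finiteAmplitude_sub_limitAmplitude_le {a : ℝ} (ha : 0 < a) (ha2 : a ≤ 1 / 2) (d : ℕ)
    {y : ℝ} (hy : ‖(a : ℂ) * airyLine y‖ ≤ 1 / 2) :
    ‖finiteAmplitude d a (a * airyLine y) - limitAmplitude d (airyLine y)‖ ≤
      (8 * d + 1) * a * ‖airyLine y‖ ^ 4 := by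
  have hac : (a : ℂ) ≠ 0 := Complex.ofReal_ne_zero.2 ha.ne'
  have hs := one_le_norm_airyLine y
  have hs0 := airyLine_ne_zero y
  have hna := norm_ofReal_mul_airyLine ha y
  have hnac : ‖(a : ℂ)‖ = a := by rw [Complex.norm_real, Real.norm_of_nonneg ha.le]
  have hu := le_norm_one_sub_exp_neg_sq ha ha2 y
  have he := le_norm_exp_sub_one (a := a) y
  have hu1 := norm_ofReal_div_le_one ha hu
  have he1 := norm_ofReal_div_le_one ha he
  have hv1 := norm_one_div_two_mul_airyLine_le y
  have hσ1 := norm_one_div_airyLine_le y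
  have hvre : 0 ≤ (1 / (2 * airyLine y)).re := by
    refine re_one_div_nonneg ?_
    simp [Complex.mul_re, airyLine_re]
  set σ := airyLine y
  set t := (a : ℂ) * σ with ht
  have ht0 : t ≠ 0 := mul_ne_zero hac hs0
  have htn : 0 < ‖t‖ := norm_pos_iff.2 ht0
  have hune : 1 - Complex.exp (-t) ^ 2 ≠ 0 := norm_pos_iff.1 (ha.trans_le hu)
  have hene : Complex.exp t - 1 ≠ 0 := norm_pos_iff.1 (ha.trans_le he)
  have huv : ‖(a : ℂ) / (1 - Complex.exp (-t) ^ 2) - 1 / (2 * σ)‖ ≤ 2 * a * ‖σ‖ := by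
    have hexp : ‖Complex.exp (-t) ^ 2 - 1 + 2 * t‖ ≤ (2 * ‖t‖) ^ 2 := by
      have h := Complex.norm_exp_sub_one_sub_id_le (x := -(2 * t)) (by
        rw [norm_neg, norm_mul, Complex.norm_ofNat]; linarith)
      rw [← Complex.exp_nat_mul]
      rw [norm_neg, norm_mul 2 t, Complex.norm_ofNat] at h
      convert h using 2
      push_cast; ring_nf
    have e : (a : ℂ) / (1 - Complex.exp (-t) ^ 2) - 1 / (2 * σ) =
        a * (Complex.exp (-t) ^ 2 - 1 + 2 * t) / ((1 - Complex.exp (-t) ^ 2) * (2 * t)) := by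
      rw [show 1 / (2 * σ) = a / (2 * t) by rw [ht]; field_simp]
      field_simp
      ring
    rw [e, norm_div, norm_mul, norm_mul, hnac, norm_mul, Complex.norm_ofNat,
      div_le_iff₀ (by positivity)]
    calc a * ‖Complex.exp (-t) ^ 2 - 1 + 2 * t‖ ≤ a * (2 * ‖t‖) ^ 2 := by gcongr
      _ = 2 * a * ‖σ‖ * (a * (2 * ‖t‖)) := by rw [hna]; ring
      _ ≤ _ := by gcongr
  -- The square root costs a factor `2 / |v| = 4 |σ|`, where `v = 1 / (2 σ)` is the limiting
  -- radicand, in the right half-plane.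
  have hroot : ‖((a : ℂ) / (1 - Complex.exp (-t) ^ 2)) ^ (1 / 2 : ℂ) -
      (1 / (2 * σ)) ^ (1 / 2 : ℂ)‖ ≤ 8 * a * ‖σ‖ ^ 2 := by
    refine (norm_cpow_half_sub_le hvre (one_div_ne_zero (mul_ne_zero two_ne_zero hs0))
      hv1).trans ?_
    rw [norm_div, norm_one, norm_mul, Complex.norm_ofNat]
    calc 2 / (1 / (2 * ‖σ‖)) * _ ≤ 2 / (1 / (2 * ‖σ‖)) * (2 * a * ‖σ‖) := by gcongr
      _ = _ := by field_simp; ring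
  have hlast : ‖(a : ℂ) / (Complex.exp t - 1) - 1 / σ‖ ≤ a * ‖σ‖ := by
    have hexp := Complex.norm_exp_sub_one_sub_id_le (x := t) (by linarith)
    have e : (a : ℂ) / (Complex.exp t - 1) - 1 / σ =
        -(a * (Complex.exp t - 1 - t)) / ((Complex.exp t - 1) * t) := by
      rw [show 1 / σ = a / t by rw [ht]; field_simp]
      field_simp
      ring
    rw [e, norm_div, norm_neg, norm_mul, norm_mul, hnac, div_le_iff₀ (by positivity)]
    calc a * ‖Complex.exp t - 1 - t‖ ≤ a * ‖t‖ ^ 2 := by gcongr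
      _ = a * ‖σ‖ * (a * ‖t‖) := by rw [hna]; ring
      _ ≤ _ := by gcongr
  have hu1' := norm_cpow_half_le_one hu1
  have hv1' := norm_cpow_half_le_one hv1
  have hpow := norm_pow_sub_pow_le hu1' hv1' d
  rw [finiteAmplitude, limitAmplitude]
  set A := ((a : ℂ) / (1 - Complex.exp (-t) ^ 2)) ^ (1 / 2 : ℂ)
  set B := (1 / (2 * σ)) ^ (1 / 2 : ℂ)
  have e : A ^ d * (a / (Complex.exp t - 1)) - B ^ d * (1 / σ) =
      (A ^ d - B ^ d) * (a / (Complex.exp t - 1)) +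
        B ^ d * (a / (Complex.exp t - 1) - 1 / σ) := by ring
  rw [e]
  refine (norm_add_le _ _).trans ?_
  rw [norm_mul, norm_mul, norm_pow B d]
  have hs2 : ‖σ‖ ^ 2 ≤ ‖σ‖ ^ 4 := pow_le_pow_right₀ hs (by norm_num)
  have hs1 : ‖σ‖ ≤ ‖σ‖ ^ 4 := le_self_pow₀ hs (by norm_num)
  calc _ ≤ (d * (8 * a * ‖σ‖ ^ 2)) * 1 + 1 * (a * ‖σ‖) := by
        gcongr
        · exact hpow.trans (by gcongr)
        · exact pow_le_one₀ (norm_nonneg _) hv1'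
    _ ≤ (d * (8 * a * ‖σ‖ ^ 4)) * 1 + 1 * (a * ‖σ‖ ^ 4) := by gcongr
    _ = _ := by ring

/-! ### Comparison of the integrands and of their integrals -/

/-- The integrand of the finite-`n` kernel on the line `1 + i y`. -/
def finiteIntegrand (d : ℕ) (a α β δ y : ℝ) : ℂ :=
  Complex.exp (finitePhase a α β δ (a * airyLine y)) * finiteAmplitude d a (a * airyLine y)

/-- The integrand of the limiting kernel on the line `1 + i y`. -/
def limitIntegrand (d : ℕ) (α δ y : ℝ) : ℂ :=
  Complex.exp (limitPhase α δ (airyLine y)) * limitAmplitude d (airyLine y)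

/-- The Gaussian that dominates `finiteIntegrand` and `limitIntegrand`. -/
def edgeGaussian (M y : ℝ) : ℝ := Real.exp (4 / 3 + M - y ^ 2 / (2 * Real.pi ^ 2))

theorem norm_limitIntegrand_le {M α δ : ℝ} (hα : |α| ≤ M) (hδ : 0 ≤ δ) (d : ℕ) (y : ℝ) :
    ‖limitIntegrand d α δ y‖ ≤ edgeGaussian M y := by
  rw [limitIntegrand, norm_mul, Complex.norm_exp]
  exact (mul_le_of_le_one_right (Real.exp_nonneg _) (norm_limitAmplitude_le d y)).trans
    (Real.exp_le_exp.2 (limitPhase_re_le hα hδ y))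

theorem norm_finiteIntegrand_le {M a α β δ : ℝ} (ha : 0 < a) (ha2 : a ≤ 1 / 2)
    (haM : M * a ^ 2 ≤ 4) (hα : |α| ≤ M) (hβ : 0 ≤ β) (hδ : 0 ≤ δ) (d : ℕ) {y : ℝ}
    (hy : |a * y| ≤ Real.pi) :
    ‖finiteIntegrand d a α β δ y‖ ≤ edgeGaussian M y := by
  rw [finiteIntegrand, norm_mul, Complex.norm_exp]
  exact (mul_le_of_le_one_right (Real.exp_nonneg _) (norm_finiteAmplitude_le ha ha2 d y)).trans
    (Real.exp_le_exp.2 (finitePhase_re_le ha ha2 haM hα hβ hδ hy))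

/-- For `|t| ≤ 1 / 2` the expansions of phase and amplitude apply. Otherwise `1 / 2 < a |σ| ≤ a
|σ|⁴`, so the separate Gaussian bounds already carry the factor `a`. -/
theorem norm_finiteIntegrand_sub_limitIntegrand_le {M a α β δ : ℝ} (ha : 0 < a) (ha2 : a ≤ 1 / 2)
    (haM : M * a ^ 2 ≤ 4) (hα : |α| ≤ M) (hβ : 0 ≤ β) (hβM : β ≤ M) (hδ : 0 ≤ δ) (hδM : δ ≤ M)
    (d : ℕ) {y : ℝ} (hy : |a * y| ≤ Real.pi) :
    ‖finiteIntegrand d a α β δ y - limitIntegrand d α δ y‖ ≤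
      (4 + 4 * M + 8 * d) * a * (‖airyLine y‖ ^ 4 * edgeGaussian M y) := by
  have hs := one_le_norm_airyLine y
  have hg : 0 ≤ edgeGaussian M y := Real.exp_nonneg _
  have hM : 0 ≤ M := hβ.trans hβM
  by_cases ht : ‖(a : ℂ) * airyLine y‖ ≤ 1 / 2
  · have h1 := norm_exp_sub_exp_le (finitePhase_re_le ha ha2 haM hα hβ hδ hy)
      (limitPhase_re_le hα hδ y)
    have h2 := norm_finitePhase_sub_limitPhase_le ha hα (abs_le.2 ⟨by linarith, hβM⟩)
      (abs_le.2 ⟨by linarith, hδM⟩) ht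
    have h3 := norm_finiteAmplitude_sub_limitAmplitude_le ha ha2 d ht
    have h4 : ‖Complex.exp (limitPhase α δ (airyLine y))‖ ≤ edgeGaussian M y := by
      rw [Complex.norm_exp]
      exact Real.exp_le_exp.2 (limitPhase_re_le hα hδ y)
    have h5 := norm_finiteAmplitude_le ha ha2 d y
    rw [finiteIntegrand, limitIntegrand]
    set E := Complex.exp (finitePhase a α β δ (a * airyLine y))
    set E₀ := Complex.exp (limitPhase α δ (airyLine y))
    set A := finiteAmplitude d a (a * airyLine y)
    set A₀ := limitAmplitude d (airyLine y)
    rw [show E * A - E₀ * A₀ = (E - E₀) * A + E₀ * (A - A₀) by ring]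
    refine (norm_add_le _ _).trans ?_
    rw [norm_mul, norm_mul]
    calc _ ≤ (edgeGaussian M y * ((2 + 4 * M) * a * ‖airyLine y‖ ^ 4)) * 1 +
          edgeGaussian M y * ((8 * d + 1) * a * ‖airyLine y‖ ^ 4) := by
          gcongr
          exact h1.trans (mul_le_mul_of_nonneg_left h2 (Real.exp_nonneg _))
      _ = (3 + 4 * M + 8 * d) * a * (‖airyLine y‖ ^ 4 * edgeGaussian M y) := by ring
      _ ≤ _ := by gcongr; norm_num
  · push Not at ht
    rw [norm_ofReal_mul_airyLine ha] at ht
    have h1 := norm_finiteIntegrand_le ha ha2 haM hα hβ hδ d hy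
    have h2 := norm_limitIntegrand_le hα hδ d y
    have hs1 : ‖airyLine y‖ ≤ ‖airyLine y‖ ^ 4 := le_self_pow₀ hs (by norm_num)
    calc _ ≤ edgeGaussian M y + edgeGaussian M y :=
          (norm_sub_le _ _).trans (add_le_add h1 h2)
      _ = 4 * (1 / 2) * edgeGaussian M y := by ring
      _ ≤ 4 * (a * ‖airyLine y‖ ^ 4) * edgeGaussian M y := by
          gcongr
          exact ht.le.trans (by gcongr)
      _ = 4 * a * (‖airyLine y‖ ^ 4 * edgeGaussian M y) := by ring
      _ ≤ _ := by gcongr; nlinarith [(Nat.cast_nonneg d : (0 : ℝ) ≤ d)]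

theorem integrable_pow_mul_edgeGaussian (M : ℝ) (k : ℕ) :
    Integrable fun y : ℝ => y ^ k * edgeGaussian M y := by
  have h := (integrable_rpow_mul_exp_neg_mul_sq (b := 1 / (2 * Real.pi ^ 2)) (by positivity)
    (s := k) (by linarith [(Nat.cast_nonneg k : (0 : ℝ) ≤ k)])).const_mul (Real.exp (4 / 3 + M))
  refine h.congr (Eventually.of_forall fun y => ?_)
  simp only [Real.rpow_natCast, edgeGaussian]
  rw [show 4 / 3 + M - y ^ 2 / (2 * Real.pi ^ 2) =
    (4 / 3 + M) + -(1 / (2 * Real.pi ^ 2)) * y ^ 2 by ring, Real.exp_add (4 / 3 + M)]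
  ring

theorem integrable_edgeGaussian (M : ℝ) : Integrable (edgeGaussian M) := by
  simpa using integrable_pow_mul_edgeGaussian M 0

theorem integrable_norm_airyLine_mul_edgeGaussian (M : ℝ) :
    Integrable fun y : ℝ => ‖airyLine y‖ ^ 4 * edgeGaussian M y := by
  have h := ((integrable_pow_mul_edgeGaussian M 0).add
    ((integrable_pow_mul_edgeGaussian M 2).const_mul 2)).add (integrable_pow_mul_edgeGaussian M 4)
  refine h.congr (Eventually.of_forall fun y => ?_)
  simp only [Pi.add_apply]
  rw [show ‖airyLine y‖ ^ 4 = (‖airyLine y‖ ^ 2) ^ 2 by ring, norm_airyLine_sq]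
  ring

theorem measurable_airyLine : Measurable airyLine := by
  unfold airyLine; fun_prop

theorem measurable_halfTanh : Measurable halfTanh := by
  unfold halfTanh; fun_prop

theorem measurable_finiteIntegrand (d : ℕ) (a α β δ : ℝ) :
    Measurable (finiteIntegrand d a α β δ) := by
  have h1 := measurable_airyLine
  have h2 := measurable_halfTanh
  unfold finiteIntegrand finitePhase finiteAmplitude
  fun_prop

theorem measurable_limitIntegrand (d : ℕ) (α δ : ℝ) : Measurable (limitIntegrand d α δ) := by
  have h1 := measurable_airyLine
  unfold limitIntegrand limitPhase limitAmplitude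
  fun_prop

theorem integrable_limitIntegrand (d : ℕ) (α : ℝ) {δ : ℝ} (hδ : 0 ≤ δ) :
    Integrable (limitIntegrand d α δ) :=
  (integrable_edgeGaussian |α|).mono' (measurable_limitIntegrand d α δ).aestronglyMeasurable
    (Eventually.of_forall fun y => norm_limitIntegrand_le le_rfl hδ d y)

/-- The finite integrand is extended by zero to the whole line. Outside the segment `a |σ| ≥ 1`, so
the tail of the limit integrand obeys the same pointwise bound. -/
theorem norm_integral_finiteIntegrand_sub_le (d : ℕ) {M : ℝ} (hM : 0 ≤ M) {a α β δ : ℝ}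
    (ha : 0 < a) (ha2 : a ≤ 1 / 2) (haM : M * a ^ 2 ≤ 4) (hα : |α| ≤ M) (hβ : 0 ≤ β)
    (hβM : β ≤ M) (hδ : 0 ≤ δ) (hδM : δ ≤ M) :
    ‖(∫ y in -(Real.pi / a)..Real.pi / a, finiteIntegrand d a α β δ y) -
        ∫ y, limitIntegrand d α δ y‖ ≤
      ((4 + 4 * M + 8 * d) * ∫ y, ‖airyLine y‖ ^ 4 * edgeGaussian M y) * a := by
  have hpa : 0 < Real.pi / a := by positivity
  have hmem : ∀ y ∈ Set.Ioc (-(Real.pi / a)) (Real.pi / a), |a * y| ≤ Real.pi := by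
    intro y hy
    have h1 : -Real.pi < a * y := by
      have := mul_lt_mul_of_pos_left hy.1 ha
      rwa [mul_neg, mul_div_cancel₀ _ ha.ne'] at this
    have h2 : a * y ≤ Real.pi := by
      have := mul_le_mul_of_nonneg_left hy.2 ha.le
      rwa [mul_div_cancel₀ _ ha.ne'] at this
    exact abs_le.2 ⟨h1.le, h2⟩
  have hnot : ∀ y ∉ Set.Ioc (-(Real.pi / a)) (Real.pi / a), 1 ≤ a * ‖airyLine y‖ := by
    intro y hy
    have h1 : Real.pi / a ≤ |y| := by
      by_contra! h
      exact hy ⟨(abs_lt.1 h).1, (abs_lt.1 h).2.le⟩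
    rw [div_le_iff₀ ha] at h1
    nlinarith [abs_le_norm_airyLine y, Real.pi_gt_three]
  rw [intervalIntegral.integral_of_le (by linarith), ← integral_indicator measurableSet_Ioc]
  have hmeas : Measurable ((Set.Ioc (-(Real.pi / a)) (Real.pi / a)).indicator
      (finiteIntegrand d a α β δ)) :=
    (measurable_finiteIntegrand d a α β δ).indicator measurableSet_Ioc
  have hint : Integrable ((Set.Ioc (-(Real.pi / a)) (Real.pi / a)).indicator
      (finiteIntegrand d a α β δ)) := by
    refine (integrable_edgeGaussian M).mono' hmeas.aestronglyMeasurable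
      (Eventually.of_forall fun y => ?_)
    by_cases hy : y ∈ Set.Ioc (-(Real.pi / a)) (Real.pi / a)
    · rw [Set.indicator_of_mem hy]
      exact norm_finiteIntegrand_le ha ha2 haM hα hβ hδ d (hmem y hy)
    · rw [Set.indicator_of_notMem hy, norm_zero]
      exact Real.exp_nonneg _
  rw [← integral_sub hint (integrable_limitIntegrand d α hδ), mul_right_comm,
    ← integral_const_mul]
  refine norm_integral_le_of_norm_le ((integrable_norm_airyLine_mul_edgeGaussian M).const_mul _)
    (Eventually.of_forall fun y => ?_)
  have hg : 0 ≤ edgeGaussian M y := Real.exp_nonneg _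
  by_cases hy : y ∈ Set.Ioc (-(Real.pi / a)) (Real.pi / a)
  · rw [Set.indicator_of_mem hy]
    exact norm_finiteIntegrand_sub_limitIntegrand_le ha ha2 haM hα hβ hβM hδ hδM d (hmem y hy)
  · rw [Set.indicator_of_notMem hy, zero_sub, norm_neg]
    have hs1 : ‖airyLine y‖ ≤ ‖airyLine y‖ ^ 4 :=
      le_self_pow₀ (one_le_norm_airyLine y) (by norm_num)
    calc _ ≤ edgeGaussian M y := norm_limitIntegrand_le hα hδ d y
      _ ≤ (a * ‖airyLine y‖) * edgeGaussian M y := le_mul_of_one_le_left hg (hnot y hy)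
      _ ≤ (a * ‖airyLine y‖ ^ 4) * edgeGaussian M y := by gcongr
      _ = 1 * a * (‖airyLine y‖ ^ 4 * edgeGaussian M y) := by ring
      _ ≤ _ := by gcongr; nlinarith [(Nat.cast_nonneg d : (0 : ℝ) ≤ d)]

/-! ### The finite kernel on the Airy contour -/

theorem prod_mehler {d : ℕ} (w : ℂ) (x y : EuclideanSpace ℝ (Fin d)) :
    ∏ k : Fin d, mehler w (x k) (y k) =
      ((1 / √Real.pi : ℝ) : ℂ) ^ d * ((1 / (1 - w ^ 2)) ^ (1 / 2 : ℂ)) ^ d *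
        Complex.exp (-((1 - w) / (1 + w)) * ((‖x + y‖ ^ 2 / 4 : ℝ) : ℂ) -
          (1 + w) / (1 - w) * ((‖x - y‖ ^ 2 / 4 : ℝ) : ℂ)) := by
  simp only [mehler, Finset.prod_mul_distrib, Finset.prod_const, Finset.card_univ,
    Fintype.card_fin]
  rw [← Complex.exp_sum]
  congr 2
  rw [EuclideanSpace.real_norm_sq_eq, EuclideanSpace.real_norm_sq_eq]
  push_cast
  rw [Finset.sum_div, Finset.sum_div, Finset.mul_sum, Finset.mul_sum, ← Finset.sum_sub_distrib]
  refine Finset.sum_congr rfl fun k _ => ?_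
  simp only [PiLp.add_apply, PiLp.sub_apply]
  push_cast
  ring

theorem fermiKernel_eq_integral_finiteIntegrand {d N : ℕ} {x y : EuclideanSpace ℝ (Fin d)}
    {a α β δ : ℝ} (ha : 0 < a) (hN : ((N + 1 : ℕ) : ℝ) = 4 / a ^ 3)
    (hadd : ‖x + y‖ ^ 2 / 4 = 8 / a ^ 3 + α / a + β * a) (hsub : ‖x - y‖ ^ 2 / 4 = δ * a) :
    (2 * Real.pi : ℂ) * ((fermiKernel d (N + 1) x y : ℝ) : ℂ) =
      ((1 / √(Real.pi * a) : ℝ) : ℂ) ^ d *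
        ∫ s in -(Real.pi / a)..Real.pi / a, finiteIntegrand d a α β δ s := by
  rw [fermiKernel_eq_integral d N x y ha]
  set H : ℝ → ℂ := fun θ => (∏ k : Fin d, mehler (Complex.exp (-(a + θ * I))) (x k) (y k)) *
        (1 - Complex.exp (-(a + θ * I)))⁻¹ * Complex.exp (N * (a + θ * I)) with hH
  have hsubst : ∫ θ in -Real.pi..Real.pi, H θ =
      ∫ s in -(Real.pi / a)..Real.pi / a, a * H (a * s) := by
    rw [intervalIntegral.integral_const_mul, intervalIntegral.integral_comp_mul_left H ha.ne',
      mul_neg, mul_div_cancel₀ _ ha.ne', Complex.real_smul, ← mul_assoc, ← Complex.ofReal_mul,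
      mul_inv_cancel₀ ha.ne', Complex.ofReal_one, one_mul]
  rw [hsubst, ← intervalIntegral.integral_const_mul]
  congr 1
  ext s
  have hac : (a : ℂ) ≠ 0 := Complex.ofReal_ne_zero.2 ha.ne'
  have ht : (a : ℂ) + ((a * s : ℝ) : ℂ) * I = a * airyLine s := (ofReal_mul_airyLine a s).symm
  have hnorm : ‖Complex.exp (-((a : ℂ) * airyLine s))‖ < 1 := by
    rw [Complex.norm_exp, Complex.neg_re, Complex.re_ofReal_mul, airyLine_re]
    simpa using ha
  simp only [hH]
  rw [prod_mehler, hadd, hsub, ht, finiteIntegrand, finitePhase, finiteAmplitude]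
  set t := (a : ℂ) * airyLine s
  have hww : Complex.exp (-t) * Complex.exp t = 1 := by
    rw [← Complex.exp_add, neg_add_cancel, Complex.exp_zero]
  -- The coefficient index is `N = n - 1`; the spare `exp (-t)` joins `1 / (1 - exp (-t))` to form
  -- `1 / (exp t - 1)`.
  have hNt : Complex.exp (N * t) = Complex.exp (4 / a ^ 3 * t) * Complex.exp (-t) := by
    rw [← Complex.exp_add]
    congr 1
    have h : (N : ℂ) + 1 = 4 / (a : ℂ) ^ 3 := by
      have := congrArg (fun r : ℝ => (r : ℂ)) hN
      push_cast at this
      exact this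
    rw [← h]; ring
  have hre := one_sub_sq_re_pos hnorm
  have hT : halfTanh t = (1 - Complex.exp (-t)) / (1 + Complex.exp (-t)) := rfl
  set w := Complex.exp (-t)
  have hne : 1 - w ^ 2 ≠ 0 := fun h => by simp [h] at hre
  have hwne : 1 - w ≠ 0 := fun h => hne (by linear_combination (1 + w) * h)
  have hene : Complex.exp t - 1 ≠ 0 := fun h => hwne (by
    linear_combination w * h - hww)
  have hroot : ((a : ℂ) / (1 - w ^ 2)) ^ (1 / 2 : ℂ) =
      ((√a : ℝ) : ℂ) * (1 / (1 - w ^ 2)) ^ (1 / 2 : ℂ) := by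
    rw [← ofReal_cpow_half ha.le, ← ofReal_mul_cpow ha (one_div_ne_zero hne)]
    congr 1; ring
  have hconst : ((1 / √(Real.pi * a) : ℝ) : ℂ) * ((√a : ℝ) : ℂ) = ((1 / √Real.pi : ℝ) : ℂ) := by
    rw [← Complex.ofReal_mul]
    congr 1
    rw [Real.sqrt_mul Real.pi_pos.le]
    have := (Real.sqrt_pos.2 ha).ne'
    field_simp
  have hfrac : (1 - w)⁻¹ * w = 1 / (Complex.exp t - 1) := by
    rw [inv_mul_eq_div, div_eq_div_iff hwne hene]
    linear_combination hww
  have hexp : Complex.exp (4 / a ^ 3 * (t - 2 * halfTanh t) - α / a * halfTanh t -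
      β * a * halfTanh t - δ * a * (1 / halfTanh t)) = Complex.exp (4 / a ^ 3 * t) *
      Complex.exp (-((1 - w) / (1 + w)) * ((8 / a ^ 3 + α / a + β * a : ℝ) : ℂ) -
          (1 + w) / (1 - w) * ((δ * a : ℝ) : ℂ)) := by
    rw [← Complex.exp_add, hT, one_div_div]
    congr 1
    push_cast
    ring
  rw [hexp, hroot, hNt, mul_pow, ← hconst, mul_pow, ← mul_one_div (a : ℂ), ← hfrac]
  ring

/-- The scale `(4 / n) ^ (1 / 3)` of the spectral variable at the edge. -/
def edgeScale (n : ℕ) : ℝ := (2 : ℝ) ^ (2 / 3 : ℝ) / (n : ℝ) ^ (1 / 3 : ℝ)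

theorem rpow_third_pow_three {x : ℝ} (hx : 0 ≤ x) : (x ^ (1 / 3 : ℝ)) ^ 3 = x := by
  rw [← Real.rpow_natCast, ← Real.rpow_mul hx]
  norm_num

theorem rpow_two_thirds {x : ℝ} (hx : 0 ≤ x) : x ^ (2 / 3 : ℝ) = (x ^ (1 / 3 : ℝ)) ^ 2 := by
  rw [← Real.rpow_natCast, ← Real.rpow_mul hx]
  norm_num

/-- The kernel at the edge as an integral over a segment of the Airy contour. -/
theorem rescaledEdgeKernel_eq {d n : ℕ} (hn : 0 < n) {X : EuclideanSpace ℝ (Fin d)}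
    (hX : ‖X‖ = √2) (U V : EuclideanSpace ℝ (Fin d)) :
    (2 * Real.pi : ℂ) * ((rescaledEdgeKernel n X U V : ℝ) : ℂ) =
      ((1 / ((2 : ℝ) ^ (1 / 3 : ℝ) * √(2 * Real.pi)) : ℝ) : ℂ) ^ d *
        ∫ s in -(Real.pi / edgeScale n)..Real.pi / edgeScale n,
          finiteIntegrand d (edgeScale n) (√2 * inner ℝ (U + V) X / (2 : ℝ) ^ (1 / 3 : ℝ))
            (‖U + V‖ ^ 2 / (8 * (2 : ℝ) ^ (2 / 3 : ℝ)))
            (‖U - V‖ ^ 2 / (8 * (2 : ℝ) ^ (2 / 3 : ℝ))) s := by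
  obtain ⟨N, rfl⟩ : ∃ N, n = N + 1 := ⟨n - 1, by omega⟩
  have hnpos : (0 : ℝ) < ((N + 1 : ℕ) : ℝ) := by positivity
  have hm3 := rpow_third_pow_three hnpos.le
  have hc3 := rpow_third_pow_three (zero_le_two (α := ℝ))
  have hm0 : 0 < ((N + 1 : ℕ) : ℝ) ^ (1 / 3 : ℝ) := Real.rpow_pos_of_pos hnpos _
  have hc0 : (0 : ℝ) < (2 : ℝ) ^ (1 / 3 : ℝ) := Real.rpow_pos_of_pos two_pos _
  have hdhalf : ((N + 1 : ℕ) : ℝ) ^ ((d : ℝ) / 2) = √((N + 1 : ℕ) : ℝ) ^ d := by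
    rw [Real.sqrt_eq_rpow, ← Real.rpow_natCast, ← Real.rpow_mul hnpos.le]
    congr 1; ring
  rw [rescaledEdgeKernel, scaledFermiKernel, edgeScale, hdhalf, rpow_two_thirds hnpos.le,
    rpow_two_thirds zero_le_two]
  set n : ℝ := ((N + 1 : ℕ) : ℝ) with hn_def
  set m := n ^ (1 / 3 : ℝ)
  set c := (2 : ℝ) ^ (1 / 3 : ℝ)
  set h : ℝ := 1 / (m ^ 2 * √2) with hh
  set a := c ^ 2 / m with ha_def
  have ha : 0 < a := by positivity
  have h2 : √(2 : ℝ) ^ 2 = 2 := Real.sq_sqrt (by norm_num)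
  have hs2 : 0 < √(2 : ℝ) := Real.sqrt_pos.2 two_pos
  have hna : n = 4 / a ^ 3 := by
    rw [ha_def, ← hm3, div_pow, div_div_eq_mul_div, show (c ^ 2) ^ 3 = (c ^ 3) ^ 2 by ring, hc3]
    ring
  have hnh : n * h = √2 / (a * c) := by
    rw [hh, ha_def, ← hm3]
    field_simp
    rw [h2, hc3]
  have hnh2 : n * h ^ 2 / 4 = a / (8 * c ^ 2) := by
    rw [hh, ha_def, ← hm3]
    field_simp
    rw [h2]; norm_num
  -- The edge condition enters here: `|X|² = 2` makes the leading term `2 n = 8 / a³`, the value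
  -- that cancels the linear part of the phase.
  have hadd : ‖√n • (X + h • U) + √n • (X + h • V)‖ ^ 2 / 4 =
      8 / a ^ 3 + (√2 * inner ℝ (U + V) X / c) / a + ‖U + V‖ ^ 2 / (8 * c ^ 2) * a := by
    have e : √n • (X + h • U) + √n • (X + h • V) = √n • ((2 : ℝ) • X + h • (U + V)) := by
      rw [← smul_add, smul_add h, two_smul]
      congr 1; abel
    rw [e, norm_smul, mul_pow, Real.norm_of_nonneg (Real.sqrt_nonneg n), Real.sq_sqrt hnpos.le,
      norm_add_sq_real, norm_smul, norm_smul, inner_smul_left, inner_smul_right, hX, mul_pow, h2,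
      mul_pow, Real.norm_eq_abs h, sq_abs, real_inner_comm, Real.norm_ofNat]
    simp only [conj_trivial]
    have e1 : √2 * inner ℝ (U + V) X / c / a = n * h * inner ℝ (U + V) X := by
      rw [hnh]; field_simp
    have e2 : ‖U + V‖ ^ 2 / (8 * c ^ 2) * a = n * h ^ 2 / 4 * ‖U + V‖ ^ 2 := by
      rw [hnh2]; ring
    have e3 : 8 / a ^ 3 = 2 * n := by rw [hna]; ring
    rw [e1, e2, e3]
    ring
  have hsub : ‖√n • (X + h • U) - √n • (X + h • V)‖ ^ 2 / 4 =
      ‖U - V‖ ^ 2 / (8 * c ^ 2) * a := by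
    have e : √n • (X + h • U) - √n • (X + h • V) = √n • h • (U - V) := by
      rw [← smul_sub, smul_sub h]
      congr 1; abel
    rw [e, norm_smul, norm_smul, mul_pow, Real.norm_of_nonneg (Real.sqrt_nonneg n),
      Real.sq_sqrt hnpos.le, mul_pow, Real.norm_eq_abs h, sq_abs]
    have e2 : ‖U - V‖ ^ 2 / (8 * c ^ 2) * a = n * h ^ 2 / 4 * ‖U - V‖ ^ 2 := by
      rw [hnh2]; ring
    rw [e2]; ring
  have key := fermiKernel_eq_integral_finiteIntegrand ha hna hadd hsub
  have hκ : h * √n * (1 / √(Real.pi * a)) = 1 / (c * √(2 * Real.pi)) := by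
    have h0 : 0 < h := by positivity
    have hsq : (h * √n * (1 / √(Real.pi * a))) ^ 2 = (1 / (c * √(2 * Real.pi))) ^ 2 := by
      clear_value h a
      rw [mul_pow, mul_pow, Real.sq_sqrt hnpos.le, div_pow, div_pow, mul_pow c,
        Real.sq_sqrt (by positivity), Real.sq_sqrt (by positivity)]
      have e : h ^ 2 * n = a / (2 * c ^ 2) := by
        linear_combination 4 * hnh2
      rw [e]
      field_simp
    exact (pow_left_inj₀ (by positivity) (by positivity) two_ne_zero).1 hsq
  rw [← one_div_pow, ← hh, ← mul_assoc, ← mul_pow, Complex.ofReal_mul, mul_left_comm, key, ← hκ,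
    Complex.ofReal_mul (h * √n), Complex.ofReal_pow,
    mul_pow ((h * √n : ℝ) : ℂ), mul_assoc]

/-! ### The limiting kernel on the Airy contour -/

theorem airyIntegrand_eq (z : ℂ) (y : ℝ) :
    airyIntegrand z y = Complex.exp (-z * airyLine y + airyLine y ^ 3 / 3) := rfl

theorem norm_airyIntegrand_ofReal (ζ y : ℝ) :
    ‖airyIntegrand (ζ : ℂ) y‖ = Real.exp (1 / 3 - ζ) * Real.exp (-1 * y ^ 2) := by
  rw [airyIntegrand_eq, Complex.norm_exp, Complex.add_re, airyLine_pow_three_div_re,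
    ← Complex.ofReal_neg, Complex.re_ofReal_mul, airyLine_re, ← Real.exp_add]
  congr 1; ring

/-- Because the contour has real part `1`, the modulus splits as a constant times `exp (-s) exp
(-y²)`. The same mechanism gives `exp (-b |Q|²)` in the `Q` variable later. -/
theorem integrable_airyIntegrand_prod (ζ : ℝ) :
    Integrable (fun p : ℝ × ℝ => airyIntegrand ((ζ + p.1 : ℝ) : ℂ) p.2)
      ((volume.restrict (Set.Ioi 0)).prod volume) := by
  have hexp : Integrable (fun s : ℝ => Real.exp (-s)) (volume.restrict (Set.Ioi 0)) :=
    integrableOn_exp_neg_Ioi 0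
  have hg := (hexp.mul_prod (integrable_exp_neg_mul_sq one_pos)).const_mul (Real.exp (1 / 3 - ζ))
  refine hg.mono' (Continuous.aestronglyMeasurable (by unfold airyIntegrand; fun_prop))
    (Eventually.of_forall fun p => ?_)
  rw [norm_airyIntegrand_ofReal, show 1 / 3 - (ζ + p.1) = 1 / 3 - ζ + -p.1 by ring, Real.exp_add,
    mul_assoc]

theorem integrableOn_airyAi (ζ : ℝ) :
    IntegrableOn (fun s : ℝ => airyAi ((ζ + s : ℝ) : ℂ)) (Set.Ioi 0) :=
  (integrable_airyIntegrand_prod ζ).integral_prod_left.const_mul _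

theorem integral_Ioi_airyIntegrand (ζ y : ℝ) :
    ∫ s in Set.Ioi (0 : ℝ), airyIntegrand ((ζ + s : ℝ) : ℂ) y =
      airyIntegrand (ζ : ℂ) y * (1 / airyLine y) := by
  have h : ∀ s : ℝ, airyIntegrand ((ζ + s : ℝ) : ℂ) y =
      airyIntegrand (ζ : ℂ) y * Complex.exp (-airyLine y * s) := by
    intro s
    rw [airyIntegrand_eq, airyIntegrand_eq, ← Complex.exp_add]
    congr 1; push_cast; ring
  simp_rw [h]
  rw [integral_const_mul, integral_exp_mul_complex_Ioi (by simp [airyLine_re])]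
  simp

theorem airyTail_eq (ζ : ℝ) :
    airyTail ζ = 1 / (2 * Real.pi) * ∫ y : ℝ, airyIntegrand (ζ : ℂ) y * (1 / airyLine y) := by
  simp only [airyTail, airyAi]
  rw [integral_const_mul, integral_integral_swap (integrable_airyIntegrand_prod ζ)]
  simp_rw [integral_Ioi_airyIntegrand]

theorem measurable_edgeIntegrand_prod {d : ℕ} (b c : ℝ) (W : EuclideanSpace ℝ (Fin d)) :
    Measurable fun p : EuclideanSpace ℝ (Fin d) × ℝ =>
      Complex.exp (-I * ((inner ℝ p.1 W : ℝ) : ℂ)) *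
        (airyIntegrand ((b * ‖p.1‖ ^ 2 + c : ℝ) : ℂ) p.2 * (1 / airyLine p.2)) := by
  have h : Measurable fun p : EuclideanSpace ℝ (Fin d) × ℝ => airyLine p.2 :=
    measurable_airyLine.comp measurable_snd
  have h2 : Continuous fun p : EuclideanSpace ℝ (Fin d) × ℝ =>
      airyIntegrand ((b * ‖p.1‖ ^ 2 + c : ℝ) : ℂ) p.2 := by
    unfold airyIntegrand; fun_prop
  have h3 : Continuous fun p : EuclideanSpace ℝ (Fin d) × ℝ =>
      Complex.exp (-I * ((inner ℝ p.1 W : ℝ) : ℂ)) := by fun_prop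
  exact h3.measurable.mul (h2.measurable.mul (h.const_div 1))

theorem integrable_exp_neg_mul_norm_sq {d : ℕ} {b : ℝ} (hb : 0 < b) :
    Integrable fun Q : EuclideanSpace ℝ (Fin d) => Real.exp (-b * ‖Q‖ ^ 2) := by
  have h := (GaussianFourier.integrable_cexp_neg_mul_sq_norm_add (V := EuclideanSpace ℝ (Fin d))
    (b := (b : ℂ)) (by simpa using hb) 0 0).norm
  refine h.congr (Eventually.of_forall fun Q => ?_)
  simp only [zero_mul, add_zero]
  rw [Complex.norm_exp]
  norm_cast

theorem integrable_edgeIntegrand_prod {d : ℕ} {b : ℝ} (hb : 0 < b) (c : ℝ)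
    (W : EuclideanSpace ℝ (Fin d)) :
    Integrable (fun p : EuclideanSpace ℝ (Fin d) × ℝ =>
      Complex.exp (-I * ((inner ℝ p.1 W : ℝ) : ℂ)) *
        (airyIntegrand ((b * ‖p.1‖ ^ 2 + c : ℝ) : ℂ) p.2 * (1 / airyLine p.2)))
      (volume.prod volume) := by
  have hg := ((integrable_exp_neg_mul_norm_sq (d := d) hb).mul_prod
    (integrable_exp_neg_mul_sq one_pos)).const_mul (Real.exp (1 / 3 - c))
  refine hg.mono' (measurable_edgeIntegrand_prod b c W).aestronglyMeasurable
    (Eventually.of_forall fun p => ?_)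
  have h1 : ‖Complex.exp (-I * ((inner ℝ p.1 W : ℝ) : ℂ))‖ = 1 := by
    rw [Complex.norm_exp]; simp
  rw [norm_mul, h1, one_mul, norm_mul, norm_airyIntegrand_ofReal]
  refine (mul_le_of_le_one_right (by positivity) (norm_one_div_airyLine_le p.2)).trans_eq ?_
  rw [show 1 / 3 - (b * ‖p.1‖ ^ 2 + c) = 1 / 3 - c + -b * ‖p.1‖ ^ 2 by ring, Real.exp_add,
    mul_assoc]

theorem edgeIntegrand_eq {d : ℕ} (X U V Q : EuclideanSpace ℝ (Fin d)) :
    edgeIntegrand X U V Q = 1 / (2 * Real.pi) *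
      ∫ y : ℝ, Complex.exp (-I * ((inner ℝ Q (U - V) : ℝ) : ℂ)) *
        (airyIntegrand (((2 : ℝ) ^ (2 / 3 : ℝ) * ‖Q‖ ^ 2 +
          inner ℝ (U + V) X / ((2 : ℝ) ^ (1 / 3 : ℝ) * ‖X‖) : ℝ) : ℂ) y * (1 / airyLine y)) := by
  rw [edgeIntegrand, airyTail_eq, integral_const_mul]
  ring

theorem integrable_edgeIntegrand {d : ℕ} (X U V : EuclideanSpace ℝ (Fin d)) :
    Integrable (edgeIntegrand X U V) := by
  have h := (integrable_edgeIntegrand_prod (Real.rpow_pos_of_pos two_pos (2 / 3))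
    (inner ℝ (U + V) X / ((2 : ℝ) ^ (1 / 3 : ℝ) * ‖X‖)) (U - V)).integral_prod_left.const_mul
    (1 / (2 * Real.pi) : ℂ)
  exact h.congr (Eventually.of_forall fun Q => (edgeIntegrand_eq X U V Q).symm)

/-- At fixed `y` this is a Gaussian Fourier transform with parameter `b σ` of positive real part. It
gives `(π / (b σ))^{d/2} exp (-|W|² / (4 b σ))`: the root is the amplitude, and the exponent is the
`1 / σ` term of `limitPhase` with `δ = |W|² / (8 b)`. -/
theorem integral_edgeIntegrand_line {d : ℕ} {b : ℝ} (hb : 0 < b) (c : ℝ)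
    (W : EuclideanSpace ℝ (Fin d)) (y : ℝ) :
    ∫ Q : EuclideanSpace ℝ (Fin d), Complex.exp (-I * ((inner ℝ Q W : ℝ) : ℂ)) *
        (airyIntegrand ((b * ‖Q‖ ^ 2 + c : ℝ) : ℂ) y * (1 / airyLine y)) =
      ((√(2 * Real.pi / b) : ℝ) : ℂ) ^ d *
        limitIntegrand d (2 * c) (‖W‖ ^ 2 / (8 * b)) y := by
  have hs0 := airyLine_ne_zero y
  have hbc : (b : ℂ) ≠ 0 := Complex.ofReal_ne_zero.2 hb.ne'
  have h : ∀ Q : EuclideanSpace ℝ (Fin d), Complex.exp (-I * ((inner ℝ Q W : ℝ) : ℂ)) *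
        (airyIntegrand ((b * ‖Q‖ ^ 2 + c : ℝ) : ℂ) y * (1 / airyLine y)) =
      (airyIntegrand (c : ℂ) y * (1 / airyLine y)) *
        Complex.exp (-(b * airyLine y) * (‖Q‖ : ℂ) ^ 2 + (-I) * ((inner ℝ W Q : ℝ) : ℂ)) := by
    intro Q
    rw [real_inner_comm, Complex.exp_add, airyIntegrand_eq, airyIntegrand_eq]
    have e : Complex.exp (-((b * ‖Q‖ ^ 2 + c : ℝ) : ℂ) * airyLine y + airyLine y ^ 3 / 3) =
        Complex.exp (-(c : ℂ) * airyLine y + airyLine y ^ 3 / 3) *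
          Complex.exp (-(b * airyLine y) * (‖Q‖ : ℂ) ^ 2) := by
      rw [← Complex.exp_add]; congr 1; push_cast; ring
    rw [e]; ring
  simp_rw [h]
  rw [integral_const_mul, GaussianFourier.integral_cexp_neg_mul_sq_norm_add (by
    rw [Complex.re_ofReal_mul, airyLine_re]; simpa using hb), finrank_euclideanSpace_fin]
  have hroot : ((Real.pi : ℂ) / (b * airyLine y)) ^ ((d : ℂ) / 2) =
      ((√(2 * Real.pi / b) : ℝ) : ℂ) ^ d * ((1 / (2 * airyLine y)) ^ (1 / 2 : ℂ)) ^ d := by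
    rw [← mul_pow, ← ofReal_cpow_half (by positivity), ← ofReal_mul_cpow (by positivity)
      (one_div_ne_zero (mul_ne_zero two_ne_zero hs0)), div_eq_mul_one_div (d : ℂ),
      Complex.cpow_nat_mul]
    congr 2
    push_cast
    field_simp
  have hexp : Complex.exp (limitPhase (2 * c) (‖W‖ ^ 2 / (8 * b)) (airyLine y)) =
      airyIntegrand (c : ℂ) y *
        Complex.exp ((-I) ^ 2 * (‖W‖ : ℂ) ^ 2 / (4 * (b * airyLine y))) := by
    rw [airyIntegrand_eq, ← Complex.exp_add, limitPhase, neg_sq, Complex.I_sq]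
    congr 1
    push_cast
    field_simp
    ring
  rw [hroot, limitIntegrand, limitAmplitude, hexp]
  ring

/-- The edge kernel as an integral over the Airy contour. -/
theorem edgeKernel_eq {d : ℕ} {X : EuclideanSpace ℝ (Fin d)} (hX : ‖X‖ = √2)
    (U V : EuclideanSpace ℝ (Fin d)) :
    (2 * Real.pi : ℂ) * edgeKernel X U V =
      ((1 / ((2 : ℝ) ^ (1 / 3 : ℝ) * √(2 * Real.pi)) : ℝ) : ℂ) ^ d *
        ∫ y, limitIntegrand d (√2 * inner ℝ (U + V) X / (2 : ℝ) ^ (1 / 3 : ℝ))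
          (‖U - V‖ ^ 2 / (8 * (2 : ℝ) ^ (2 / 3 : ℝ))) y := by
  have hb : (0 : ℝ) < (2 : ℝ) ^ (2 / 3 : ℝ) := Real.rpow_pos_of_pos two_pos _
  have hc : (0 : ℝ) < (2 : ℝ) ^ (1 / 3 : ℝ) := Real.rpow_pos_of_pos two_pos _
  have hbc := rpow_two_thirds (zero_le_two (α := ℝ))
  simp_rw [edgeKernel, edgeIntegrand_eq]
  rw [integral_const_mul, integral_integral_swap (integrable_edgeIntegrand_prod hb _ _)]
  simp_rw [integral_edgeIntegrand_line hb]
  rw [integral_const_mul, hX]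
  have hα : 2 * (inner ℝ (U + V) X / ((2 : ℝ) ^ (1 / 3 : ℝ) * √2)) =
      √2 * inner ℝ (U + V) X / (2 : ℝ) ^ (1 / 3 : ℝ) := by
    have h2 : √(2 : ℝ) ^ 2 = 2 := Real.sq_sqrt (by norm_num)
    field_simp
    rw [h2, mul_comm]
  have hκ : 1 / (2 * Real.pi) * √(2 * Real.pi / (2 : ℝ) ^ (2 / 3 : ℝ)) =
      1 / ((2 : ℝ) ^ (1 / 3 : ℝ) * √(2 * Real.pi)) := by
    have hp : 0 < √(2 * Real.pi) := Real.sqrt_pos.2 (by positivity)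
    rw [Real.sqrt_div (by positivity), hbc, Real.sqrt_sq hc.le]
    field_simp
    rw [Real.sq_sqrt (by positivity)]
  rw [hα, ← hκ]
  have hpi : (2 * Real.pi : ℂ) ≠ 0 := by
    exact_mod_cast (by positivity : (2 * Real.pi : ℝ) ≠ 0)
  have h : ∀ R J : ℂ, 2 * Real.pi * (1 / (2 * Real.pi) ^ d * (1 / (2 * Real.pi) * (R ^ d * J))) =
      (1 / (2 * Real.pi) * R) ^ d * J := by
    intro R J
    rw [mul_pow (1 / (2 * Real.pi : ℂ)), one_div_pow]
    field_simp
  rw [h]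
  push_cast
  rfl

/-! ### Uniform convergence on compact sets -/

theorem tendsto_edgeScale : Tendsto edgeScale atTop (𝓝 0) :=
  Tendsto.const_div_atTop ((tendsto_rpow_atTop (by norm_num)).comp tendsto_natCast_atTop_atTop) _

theorem edgeScale_pos {n : ℕ} (hn : 0 < n) : 0 < edgeScale n := by
  have : (0 : ℝ) < n := Nat.cast_pos.2 hn
  unfold edgeScale
  positivity

theorem edgeScale_eq (n : ℕ) : edgeScale n = (2 : ℝ) ^ (2 / 3 : ℝ) * (n : ℝ) ^ (-(1 / 3) : ℝ) := by
  rw [edgeScale, Real.rpow_neg (Nat.cast_nonneg n), div_eq_mul_inv]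

theorem exists_norm_rescaledEdgeKernel_sub_le {d : ℕ} {X : EuclideanSpace ℝ (Fin d)}
    (hX : ‖X‖ = √2) {S : Set (EuclideanSpace ℝ (Fin d) × EuclideanSpace ℝ (Fin d))}
    (hS : IsCompact S) :
    ∃ C : ℝ, ∀ᶠ n : ℕ in atTop, ∀ p ∈ S,
      ‖((rescaledEdgeKernel n X p.1 p.2 : ℝ) : ℂ) - edgeKernel X p.1 p.2‖
        ≤ C * (n : ℝ) ^ (-(1 / 3) : ℝ) := by
  obtain ⟨M₁, hM₁⟩ := hS.exists_bound_of_continuousOn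
    (f := fun p => √2 * inner ℝ (p.1 + p.2) X / (2 : ℝ) ^ (1 / 3 : ℝ)) (by fun_prop)
  obtain ⟨M₂, hM₂⟩ := hS.exists_bound_of_continuousOn
    (f := fun p => ‖p.1 + p.2‖ ^ 2 / (8 * (2 : ℝ) ^ (2 / 3 : ℝ))) (by fun_prop)
  obtain ⟨M₃, hM₃⟩ := hS.exists_bound_of_continuousOn
    (f := fun p => ‖p.1 - p.2‖ ^ 2 / (8 * (2 : ℝ) ^ (2 / 3 : ℝ))) (by fun_prop)
  -- Absolute values, because the bounds supplied by compactness may be negative when `S` is empty.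
  set M := |M₁| + |M₂| + |M₃| with hM
  have hM0 : 0 ≤ M := by positivity
  have h1 : M₁ ≤ M := by linarith [le_abs_self M₁, abs_nonneg M₂, abs_nonneg M₃]
  have h2 : M₂ ≤ M := by linarith [le_abs_self M₂, abs_nonneg M₁, abs_nonneg M₃]
  have h3 : M₃ ≤ M := by linarith [le_abs_self M₃, abs_nonneg M₁, abs_nonneg M₂]
  set κ : ℝ := 1 / ((2 : ℝ) ^ (1 / 3 : ℝ) * √(2 * Real.pi)) with hκ
  have hκ0 : 0 ≤ κ := by positivity
  set C₀ : ℝ := (4 + 4 * M + 8 * d) * ∫ y, ‖airyLine y‖ ^ 4 * edgeGaussian M y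
  refine ⟨κ ^ d * (C₀ * (2 : ℝ) ^ (2 / 3 : ℝ)), ?_⟩
  have ha2 : ∀ᶠ n in atTop, edgeScale n ≤ 1 / 2 :=
    tendsto_edgeScale.eventually_le_const (by norm_num)
  have haM : ∀ᶠ n in atTop, M * edgeScale n ^ 2 ≤ 4 := by
    have h := (tendsto_edgeScale.pow 2).const_mul M
    exact h.eventually_le_const (by norm_num)
  filter_upwards [ha2, haM, eventually_gt_atTop 0] with n hn2 hnM hn p hp
  have hα := (hM₁ p hp).trans h1
  have hβ := ((Real.le_norm_self _).trans (hM₂ p hp)).trans h2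
  have hδ := ((Real.le_norm_self _).trans (hM₃ p hp)).trans h3
  have key := norm_integral_finiteIntegrand_sub_le d hM0 (edgeScale_pos hn) hn2 hnM hα
    (by positivity) hβ (by positivity) hδ
  have hnorm := congrArg norm (mul_sub (2 * Real.pi : ℂ)
    ((rescaledEdgeKernel n X p.1 p.2 : ℝ) : ℂ) (edgeKernel X p.1 p.2))
  rw [rescaledEdgeKernel_eq hn hX, edgeKernel_eq hX, ← mul_sub] at hnorm
  rw [norm_mul, norm_mul, norm_mul, norm_pow, Complex.norm_real, Complex.norm_real,
    Real.norm_of_nonneg hκ0, Real.norm_of_nonneg Real.pi_pos.le, Complex.norm_ofNat] at hnorm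
  have hle := mul_le_mul_of_nonneg_left key (pow_nonneg hκ0 d)
  rw [← hnorm, edgeScale_eq] at hle
  refine le_trans ?_ (hle.trans_eq (by ring))
  -- The factor `2 π ≥ 1` on the left is simply dropped.
  exact le_mul_of_one_le_left (norm_nonneg _) (by linarith [Real.pi_gt_three])

end FermiEdge

end

theorem mainTheorem5 (d : ℕ) (X : EuclideanSpace ℝ (Fin d)) (hX : ‖X‖ = √2) :
    ((∀ ζ : ℝ, IntegrableOn (fun s : ℝ => FermiEdge.airyAi ((ζ + s : ℝ) : ℂ)) (Set.Ioi 0)) ∧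
      ∀ U V : EuclideanSpace ℝ (Fin d), Integrable (FermiEdge.edgeIntegrand X U V)) ∧
    ∀ S : Set (EuclideanSpace ℝ (Fin d) × EuclideanSpace ℝ (Fin d)), IsCompact S →
      ∃ C : ℝ, ∀ᶠ n : ℕ in atTop, ∀ p ∈ S,
        ‖((FermiEdge.rescaledEdgeKernel n X p.1 p.2 : ℝ) : ℂ) - FermiEdge.edgeKernel X p.1 p.2‖
          ≤ C * (n : ℝ) ^ (-(1 / 3) : ℝ) :=
  ⟨⟨FermiEdge.integrableOn_airyAi, FermiEdge.integrable_edgeIntegrand X⟩,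
    fun _ hS => FermiEdge.exists_norm_rescaledEdgeKernel_sub_le hX hS⟩
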